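/- Let $\pi=\{e,\sigma\}$ be the group with two elements and work over $\mathbb F_2$. Let $E\pi$ be the simplicial set with $(E\pi)_n=\pi^{n+1}$ (faces omit, degeneracies repeat an entry), let $B\pi=E\pi/\pi$ (so $(B\pi)_n\cong\pi^{n}$), and write $\bar a$ for the image of $a\in E\pi$ in $B\pi$. For a simplicial $\mathbb F_2$-module $A$ let $NA$ be the normalized chain complex (the quotient by degenerate elements), and let $\mathbb F_2E\pi\otimes_\pi A^{\otimes 2}$ be formed degreewise, $\sigma$ exchanging the two factors $A$. Let $\overline W=N\mathbb F_2B\pi$, with the comultiplication given by the diagonal of $B\pi$ (induced by that of $E\pi$) followed by the Alexander–Whitney map $AW$, and the augmentation as counit. Let $V$ be a cosimplicial simplicial $\mathbb F_2$-module. Let $\operatorname{Tot}V$ be the simplicial module whose $q$-simplices are the families of simplicial maps $f^p:\Delta^p\times\Delta^q\to V^p$ compatible with the cosimplicial operators, let $C$ be conormalization (the quotient of $Y^k$ by the images of $d^1,\dots,d^k$, with differential induced by $d^0$), and let $T$ be the product total complex, $(TCNV)_m=\prod_{k\ge 0}C^kN_{m+k}V$ for $m\in\mathbb Z$. The interchange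 map $\zeta:\mathbb F_2E\pi\otimes_\pi(\operatorname{Tot}V)^{\otimes 2}\to\operatorname{Tot}(\mathbb F_2E\pi\otimes_\pi V^{\otimes 2})$ sends $e\otimes f\otimes g$ to $(a,b)\mapsto e(b)\otimes f(a,b)\otimes g(a,b)$, and $\phi_\infty:N\operatorname{Tot}V\to TCNV$ sends $f$ of degree $q$ to the family of the classes of $f^k(\imath_k\wedge\imath_q)$, $k\ge0$, where $\imath_k\wedge\imath_q$ is the shuffle product of the top simplices of $\Delta^k$ and $\Delta^q$. For a graded module $M$ let $\overline W\mathbin{\widehat\otimes}M$ be the completed tensor product, $(\overline W\mathbin{\widehat\otimes}M)_n=\prod_{r\ge 0}\overline W_r\otimes M_{n-r}$; this is $\overline W\otimes M$ if $M$ is bounded below, and $\overline W\mathbin{\widehat\otimes}TD\cong T(\overline W\otimes D)$ for a second-quadrant bicomplex $D$. By a comodule over $\overline W$ is meant a complex $M$ with a counital and coassociative chain map $M\to\overline W\mathbin{\widehat\otimes}M$. For a simplicial module $A$, the map $\varrho_1(a\otimes z)=\bar a\otimes(a\otimes z)$ followed by $AW$ gives $\varrho_2:N(\mathbb F_2E\pi\otimes_\pi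 A^{\otimes2})\to\overline W\otimes N(\mathbb F_2E\pi\otimes_\pi A^{\otimes2})$; applying $\varrho_2$ in each cosimplicial degree gives $\varrho_3:TCN(\mathbb F_2E\pi\otimes_\pi V^{\otimes2})\to\overline W\mathbin{\widehat\otimes}TCN(\mathbb F_2E\pi\otimes_\pi V^{\otimes2})$. Then $\overline W$ is a differential graded coalgebra; $\varrho_2$ (for $A=\operatorname{Tot}V$) and $\varrho_3$ make $N(\mathbb F_2E\pi\otimes_\pi(\operatorname{Tot}V)^{\otimes 2})$ and $TCN(\mathbb F_2E\pi\otimes_\pi V^{\otimes2})$ comodules over $\overline W$; and $$\phi_\infty\circ N(\zeta):N(\mathbb F_2E\pi\otimes_\pi(\operatorname{Tot}V)^{\otimes 2})\to TCN(\mathbb F_2E\pi\otimes_\pi V^{\otimes2})$$ is a chain map that commutes with the coactions, that is, it is a map of comodules over $\overline W$. -/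

import Mathlib

open CategoryTheory Opposite Simplicial TensorProduct

universe u v w

noncomputable section

namespace TotComod

/-- The ground field with two elements, `ℤ/2`. -/
def F2 : Type := ZMod 2

/-- The usual field structure on `ℤ/2`. -/
def F2.field : Field F2 := inferInstanceAs (Field (ZMod 2))

instance : Field F2 := F2.field

instance : CharP F2 2 := inferInstanceAs (CharP (ZMod 2) 2)

lemma add_self_zero {M : Type*} [AddCommGroup M] [Module F2 M] (x : M) : x + x = 0 := by
  rw [← two_smul F2 x, CharTwo.two_eq_zero, zero_smul]

/-- Simplicial `F2`-modules. -/
abbrev SMod := SimplicialObject (ModuleCat.{u} F2)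

/-- Cosimplicial simplicial `F2`-modules, functors from the simplex category to simplicial
`F2`-modules. -/
abbrev CSMod := SimplexCategory ⥤ SMod.{u}

/-! ## Generalities on order maps -/

/-- The action of an order map on a simplicial module. -/
def act (A : SMod.{u}) {m n : SimplexCategory} (θ : m ⟶ n) :
    A.obj (op n) →ₗ[F2] A.obj (op m) := (A.map θ.op).hom

lemma act_act (A : SMod.{u}) {l m n : SimplexCategory} (η : l ⟶ m) (θ : m ⟶ n)
    (x : A.obj (op n)) : act A η (act A θ x) = act A (η ≫ θ) x := by
  simp [act]

lemma act_id (A : SMod.{u}) {n : SimplexCategory} (x : A.obj (op n)) : act A (𝟙 n) x = x := by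
  simp [act]

lemma app_act {A B : SMod.{u}} (f : A ⟶ B) {m n : SimplexCategory} (θ : m ⟶ n)
    (x : A.obj (op n)) :
    (f.app (op m)).hom (act A θ x) = act B θ ((f.app (op n)).hom x) := by
  have h := congrArg (fun g => g.hom x) (f.naturality θ.op)
  simpa [act] using h

/-- An order map which is constant on a step factors through the corresponding degeneracy. -/
lemma factor_of_eq {n : ℕ} {X : SimplexCategory} (θ : ⦋n + 1⦌ ⟶ X) (i : Fin (n + 1))
    (h : θ.toOrderHom i.castSucc = θ.toOrderHom i.succ) :
    θ = SimplexCategory.σ i ≫ (SimplexCategory.δ i.succ ≫ θ) := by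
  ext j : 3
  simp only [SimplexCategory.comp_toOrderHom, OrderHom.comp_coe, Function.comp_apply]
  change θ.toOrderHom j = θ.toOrderHom (i.succ.succAbove (i.predAbove j))
  rcases lt_trichotomy j i.succ with hj | hj | hj
  · rw [Fin.predAbove_of_le_castSucc _ _ (by
      rw [Fin.le_def]; rw [Fin.lt_def] at hj; simp at hj ⊢; omega)]
    rw [Fin.succAbove_of_castSucc_lt _ _ (by simpa using hj)]
    simp
  · subst hj
    rw [Fin.predAbove_of_castSucc_lt _ _ (by simp)]
    rw [Fin.succAbove_of_castSucc_lt _ _ (by simp [Fin.lt_def])]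
    simp [h]
  · have h0 : i.castSucc < j := lt_trans (by simp) hj
    rw [Fin.predAbove_of_castSucc_lt _ _ h0]
    rw [Fin.succAbove_of_lt_succ _ _ (by simpa using hj)]
    simp

lemma exists_step {n m : ℕ} (θ : ⦋n⦌ ⟶ ⦋m⦌) (h : m < n) :
    ∃ (l : ℕ) (e : n = l + 1) (i : Fin (l + 1)),
      θ.toOrderHom (Fin.cast (by simp [e]) i.castSucc) =
        θ.toOrderHom (Fin.cast (by simp [e]) i.succ) := by
  obtain ⟨l, rfl⟩ : ∃ l, n = l + 1 := ⟨n - 1, by omega⟩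
  refine ⟨l, rfl, ?_⟩
  by_contra! hc
  have hs : StrictMono (fun i : Fin (l + 1 + 1) => (θ.toOrderHom i : Fin (m + 1))) := by
    rw [Fin.strictMono_iff_lt_succ]
    intro i
    exact lt_of_le_of_ne (θ.toOrderHom.monotone (by simp [Fin.le_def])) (hc i)
  have := Fintype.card_le_of_injective _ hs.injective
  simp at this
  omega

/-! ## Normalized chains -/

/-- The submodule of degenerate elements, spanned by the images of the degeneracies. -/
def degen (A : SMod.{u}) (n : ℕ) : Submodule F2 (A _⦋n⦌) :=
  match n with
  | 0 => ⊥
  | n + 1 => ⨆ i : Fin (n + 1), LinearMap.range (A.σ i).hom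

lemma act_mem_degen (A : SMod.{u}) {n : ℕ} {X : SimplexCategory} (θ : ⦋n + 1⦌ ⟶ X)
    (i : Fin (n + 1)) (h : θ.toOrderHom i.castSucc = θ.toOrderHom i.succ) (x : A.obj (op X)) :
    act A θ x ∈ degen A (n + 1) := by
  rw [factor_of_eq θ i h, ← act_act]
  exact Submodule.mem_iSup_of_mem i ⟨_, rfl⟩

lemma act_mem_degen_of_lt (A : SMod.{u}) {n m : ℕ} (θ : ⦋n⦌ ⟶ ⦋m⦌) (h : m < n)
    (x : A _⦋m⦌) : act A θ x ∈ degen A n := by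
  obtain ⟨l, rfl, i, hi⟩ := exists_step θ h
  exact act_mem_degen A θ i hi x

lemma degen_le (A : SMod.{u}) (n : ℕ) (P : Submodule F2 (A _⦋n⦌))
    (h : ∀ (m : ℕ) (θ : ⦋n⦌ ⟶ ⦋m⦌), m < n → ∀ x, act A θ x ∈ P) : degen A n ≤ P := by
  cases n with
  | zero => exact bot_le
  | succ n =>
    refine iSup_le fun i => ?_
    rintro _ ⟨x, rfl⟩
    exact h n (SimplexCategory.σ i) (Nat.lt_succ_self n) x

/-- Normalized chains in degree `n`: the quotient by the degenerate elements. -/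
abbrev NC (A : SMod.{u}) (n : ℕ) : Type u := A _⦋n⦌ ⧸ degen A n

/-- The class in the normalized chains. -/
abbrev NC.mk (A : SMod.{u}) (n : ℕ) : A _⦋n⦌ →ₗ[F2] NC A n := (degen A n).mkQ

lemma NC.mk_act_eq_zero (A : SMod.{u}) {n m : ℕ} (θ : ⦋n⦌ ⟶ ⦋m⦌) (h : m < n)
    (x : A _⦋m⦌) : NC.mk A n (act A θ x) = 0 := by
  simpa using act_mem_degen_of_lt A θ h x

/-- The unnormalized boundary, the sum of the faces (signs do not matter over `F2`). -/
def bdry (A : SMod.{u}) (n : ℕ) : A _⦋n + 1⦌ →ₗ[F2] A _⦋n⦌ :=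
  ∑ k : Fin (n + 2), (A.δ k).hom

lemma bdry_degen (A : SMod.{u}) (n : ℕ) :
    degen A (n + 1) ≤ (degen A n).comap (bdry A n) := by
  refine iSup_le fun i => ?_
  rintro _ ⟨x, rfl⟩
  rw [Submodule.mem_comap, ← Submodule.Quotient.mk_eq_zero, ← Submodule.mkQ_apply]
  simp only [bdry, LinearMap.sum_apply, map_sum]
  have key : ∀ k : Fin (n + 2),
      (A.δ k).hom ((A.σ i).hom x) = act A (SimplexCategory.δ k ≫ SimplexCategory.σ i) x := by
    intro k; rw [← act_act]; rfl
  simp only [key]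
  rw [Finset.sum_eq_add i.castSucc i.succ (by simp [Fin.ext_iff])]
  · rw [SimplexCategory.δ_comp_σ_self, SimplexCategory.δ_comp_σ_succ, act_id]
    exact add_self_zero _
  · rintro k - ⟨h1, h2⟩
    cases n with
    | zero =>
      exfalso
      have hi : (i : ℕ) = 0 := by omega
      rw [Ne, Fin.ext_iff] at h1 h2
      simp at h1 h2
      omega
    | succ n =>
      rcases lt_or_gt_of_ne h1 with h | h
      · obtain ⟨j, rfl⟩ : ∃ j : Fin (n + 2), k = j.castSucc :=
          ⟨⟨k, by rw [Fin.lt_def] at h; simp at h; omega⟩, by simp [Fin.ext_iff]⟩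
        obtain ⟨i, rfl⟩ : ∃ i' : Fin (n + 1), i = i'.succ :=
          ⟨⟨i - 1, by rw [Fin.lt_def] at h; simp at h; omega⟩, by
            rw [Fin.lt_def] at h; simp [Fin.ext_iff] at h ⊢; omega⟩
        rw [SimplexCategory.δ_comp_σ_of_le (by
          rw [Fin.lt_def] at h; rw [Fin.le_def]; simp at h ⊢; omega), ← act_act]
        exact NC.mk_act_eq_zero A _ (Nat.lt_succ_self _) _
      · obtain ⟨j, rfl⟩ : ∃ j : Fin (n + 2), k = j.succ :=
          ⟨⟨k - 1, by omega⟩, by rw [Fin.lt_def] at h; simp [Fin.ext_iff] at h ⊢; omega⟩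
        have h3 : i < j := by
          rw [Ne, Fin.ext_iff] at h2
          rw [Fin.lt_def] at h
          rw [Fin.lt_def]
          simp at h h2
          omega
        obtain ⟨i, rfl⟩ : ∃ i' : Fin (n + 1), i = i'.castSucc :=
          ⟨⟨i, by rw [Fin.lt_def] at h3; omega⟩, by simp [Fin.ext_iff]⟩
        rw [SimplexCategory.δ_comp_σ_of_gt h3, ← act_act]
        exact NC.mk_act_eq_zero A _ (Nat.lt_succ_self _) _
  · simp
  · simp

/-- The differential of the normalized chain complex. -/
def NC.d (A : SMod.{u}) (n : ℕ) : NC A (n + 1) →ₗ[F2] NC A n :=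
  (degen A (n + 1)).mapQ (degen A n) (bdry A n) (bdry_degen A n)

/-- The map of normalized chains induced by a map of simplicial modules. -/
def NC.map {A B : SMod.{u}} (f : A ⟶ B) (n : ℕ) : NC A n →ₗ[F2] NC B n :=
  (degen A n).mapQ (degen B n) (f.app (op ⦋n⦌)).hom (degen_le A n _ fun m θ h x => by
    rw [Submodule.mem_comap, app_act]
    exact act_mem_degen_of_lt B θ h _)

lemma NC.map_mk {A B : SMod.{u}} (f : A ⟶ B) (n : ℕ) (x : A _⦋n⦌) :
    NC.map f n (NC.mk A n x) = NC.mk B n ((f.app (op ⦋n⦌)).hom x) := rfl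

lemma NC.d_map {A B : SMod.{u}} (f : A ⟶ B) (n : ℕ) (x : NC A (n + 1)) :
    NC.d B n (NC.map f (n + 1) x) = NC.map f n (NC.d A n x) := by
  obtain ⟨x, rfl⟩ := Submodule.mkQ_surjective _ x
  change NC.mk B n _ = NC.mk B n _
  congr 1
  simp only [bdry, LinearMap.sum_apply, map_sum]
  refine Finset.sum_congr rfl fun k _ => ?_
  exact (app_act f (SimplexCategory.δ k) x).symm

lemma NC.map_comp {A B D : SMod.{u}} (f : A ⟶ B) (g : B ⟶ D) (n : ℕ) (x : NC A n) :
    NC.map (f ≫ g) n x = NC.map g n (NC.map f n x) := by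
  obtain ⟨x, rfl⟩ := Submodule.mkQ_surjective _ x
  rfl

/-! ## Tensor products and the Alexander-Whitney map -/

/-- The degreewise tensor product of simplicial modules. -/
def tens (A : SMod.{u}) (B : SMod.{v}) : SMod.{max u v} where
  obj X := ModuleCat.of F2 (A.obj X ⊗[F2] B.obj X)
  map f := ModuleCat.ofHom (TensorProduct.map (A.map f).hom (B.map f).hom)
  map_id X := by
    ext : 1
    simp
  map_comp f g := by
    ext : 1
    simp [TensorProduct.map_comp]

/-- The front face `[p] → [p + q]`, `i ↦ i`; it induces `d_{p+1} ⋯ d_{p+q}`. -/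
def front (p q n : ℕ) (h : n = p + q) : ⦋p⦌ ⟶ ⦋n⦌ :=
  SimplexCategory.Hom.mk ⟨fun i => ⟨i, by have := i.2; simp at this ⊢; omega⟩,
    fun _ _ hij => hij⟩

/-- The back face `[q] → [p + q]`, `j ↦ p + j`; it induces `d_0 ⋯ d_{p-1}`. -/
def back (p q n : ℕ) (h : n = p + q) : ⦋q⦌ ⟶ ⦋n⦌ :=
  SimplexCategory.Hom.mk ⟨fun j => ⟨p + j, by have := j.2; simp at this ⊢; omega⟩,
    fun _ _ hij => by rw [Fin.le_def] at hij ⊢; simpa using hij⟩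

/-- The component `N_n(A ⊗ B) → N_p A ⊗ N_q B` of the Alexander-Whitney map, before passing
to the quotient by degenerate elements in the source. -/
def awPre (A : SMod.{u}) (B : SMod.{v}) (p q n : ℕ) (h : n = p + q) :
    (tens A B) _⦋n⦌ →ₗ[F2] NC A p ⊗[F2] NC B q :=
  TensorProduct.map (NC.mk A p ∘ₗ act A (front p q n h)) (NC.mk B q ∘ₗ act B (back p q n h))

lemma awPre_degen (A : SMod.{u}) (B : SMod.{v}) (p q n : ℕ) (h : n = p + q) :
    degen (tens A B) n ≤ LinearMap.ker (awPre A B p q n h) := by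
  refine degen_le _ _ _ fun m θ hm x => ?_
  rw [LinearMap.mem_ker]
  change awPre A B p q n h (TensorProduct.map (act A θ) (act B θ) x) = 0
  obtain ⟨l, rfl, i, hi⟩ := exists_step θ hm
  have key : TensorProduct.map (NC.mk A p ∘ₗ act A (front p q (l + 1) h))
      (NC.mk B q ∘ₗ act B (back p q (l + 1) h)) ∘ₗ TensorProduct.map (act A θ) (act B θ) = 0 := by
    refine TensorProduct.ext' fun a b => ?_
    simp only [TensorProduct.map_tmul, LinearMap.comp_apply, LinearMap.zero_apply]
    rw [act_act, act_act]
    by_cases hip : (i : ℕ) < p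
    · obtain ⟨p, rfl⟩ : ∃ p', p = p' + 1 := ⟨p - 1, by omega⟩
      have : NC.mk A (p + 1) (act A (front (p + 1) q (l + 1) h ≫ θ) a) = 0 := by
        rw [Submodule.mkQ_apply, Submodule.Quotient.mk_eq_zero]
        exact act_mem_degen A _ ⟨i, hip⟩ hi a
      rw [this, TensorProduct.zero_tmul]
    · obtain ⟨q, rfl⟩ : ∃ q', q = q' + 1 := ⟨q - 1, by have := i.2; omega⟩
      have : NC.mk B (q + 1) (act B (back p (q + 1) (l + 1) h ≫ θ) b) = 0 := by
        rw [Submodule.mkQ_apply, Submodule.Quotient.mk_eq_zero]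
        refine act_mem_degen B _ ⟨i - p, by have := i.2; omega⟩ ?_ b
        have hil : (i : ℕ) - p < q + 1 := by have := i.2; omega
        have e1 : (back p (q + 1) (l + 1) h).toOrderHom
            (Fin.castSucc ⟨i - p, hil⟩) = i.castSucc := by
          apply Fin.ext
          change p + ((i : ℕ) - p) = i
          omega
        have e2 : (back p (q + 1) (l + 1) h).toOrderHom
            (Fin.succ ⟨i - p, hil⟩) = i.succ := by
          apply Fin.ext
          change p + ((i : ℕ) - p + 1) = i + 1
          omega
        exact (congrArg θ.toOrderHom e1).trans (hi.trans (congrArg θ.toOrderHom e2).symm)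
      rw [this, TensorProduct.tmul_zero]
  exact LinearMap.congr_fun key x

/-- The component `N_n(A ⊗ B) → N_p A ⊗ N_q B`, `n = p + q`, of the Alexander-Whitney map. -/
def aw (A : SMod.{u}) (B : SMod.{v}) (p q n : ℕ) (h : n = p + q) :
    NC (tens A B) n →ₗ[F2] NC A p ⊗[F2] NC B q :=
  (degen (tens A B) n).liftQ (awPre A B p q n h) (awPre_degen A B p q n h)

lemma awPre_natural (A : SMod.{u}) {B B' : SMod.{v}} (g : B ⟶ B') (p q n : ℕ) (h : n = p + q) :
    awPre A B' p q n h ∘ₗ TensorProduct.map LinearMap.id (g.app (op ⦋n⦌)).hom =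
      LinearMap.lTensor (NC A p) (NC.map g q) ∘ₗ awPre A B p q n h := by
  refine TensorProduct.ext' fun a b => ?_
  change NC.mk A p (act A (front p q n h) a) ⊗ₜ[F2]
      NC.mk B' q (act B' (back p q n h) ((g.app (op ⦋n⦌)).hom b)) =
    NC.mk A p (act A (front p q n h) a) ⊗ₜ[F2]
      NC.map g q (NC.mk B q (act B (back p q n h) b))
  rw [NC.map_mk, app_act]

/-! ## Free modules -/

/-- The free module `F2[S]` on a set `S`. -/
def Lin (S : Type) : Type := S →₀ F2

instance (S : Type) : AddCommGroup (Lin S) := inferInstanceAs (AddCommGroup (S →₀ F2))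

instance (S : Type) : Module F2 (Lin S) := inferInstanceAs (Module F2 (S →₀ F2))

instance (S : Type) [Finite S] : Module.Finite F2 (Lin S) :=
  inferInstanceAs (Module.Finite F2 (S →₀ F2))

/-- The basis elements of `F2[S]`. -/
def Lin.of {S : Type} (s : S) : Lin S := Finsupp.single s (1 : F2)

/-- The linear extension of a map from `S` to a module. -/
def Lin.lift {S : Type} {M : Type u} [AddCommGroup M] [Module F2 M] (f : S → M) :
    Lin S →ₗ[F2] M := Finsupp.linearCombination F2 f

@[simp]
lemma Lin.lift_of {S : Type} {M : Type u} [AddCommGroup M] [Module F2 M] (f : S → M) (s : S) :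
    Lin.lift f (Lin.of s) = f s := by
  refine (Finsupp.linearCombination_single F2 (1 : F2) s).trans ?_
  simp

lemma Lin.ext {S : Type} {M : Type u} [AddCommGroup M] [Module F2 M] {f g : Lin S →ₗ[F2] M}
    (h : ∀ s, f (Lin.of s) = g (Lin.of s)) : f = g := by
  refine Finsupp.lhom_ext' (M := F2) fun s => LinearMap.ext_ring ?_
  exact h s

/-- The functoriality of `F2[S]`. -/
def Lin.map {S T : Type} (f : S → T) : Lin S →ₗ[F2] Lin T := Lin.lift fun s => Lin.of (f s)

@[simp]
lemma Lin.map_of {S T : Type} (f : S → T) (s : S) : Lin.map f (Lin.of s) = Lin.of (f s) := by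
  simp [Lin.map]

/-- The diagonal `F2[S] → F2[S] ⊗ F2[S]`, `s ↦ s ⊗ s`. -/
def diag (S : Type) : Lin S →ₗ[F2] Lin S ⊗[F2] Lin S :=
  Lin.lift fun s => Lin.of s ⊗ₜ[F2] Lin.of s

@[simp]
lemma diag_of {S : Type} (s : S) : diag S (Lin.of s) = Lin.of s ⊗ₜ[F2] Lin.of s := by
  simp [diag]

/-! ## The spaces `Eπ` and `Bπ` -/

/-- The group with two elements, written multiplicatively. -/
abbrev Pi2 := Multiplicative (ZMod 2)

/-- The nontrivial element of the group with two elements. -/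
def sig : Pi2 := Multiplicative.ofAdd 1

/-- `(Eπ)_n = π^{n+1}`. -/
abbrev EObj (X : SimplexCategory) : Type := Fin (X.len + 1) → Pi2

/-- The simplicial structure of `Eπ`: faces omit and degeneracies repeat entries. -/
def EMap {X Y : SimplexCategory} (θ : X ⟶ Y) (e : EObj Y) : EObj X :=
  fun i => e (θ.toOrderHom i)

/-- `Bπ` is the quotient of `Eπ` by the free diagonal action of `π`. In degree `n` it is
identified with `π^n` by `[g_0, …, g_n] ↦ (g_0⁻¹ g_1, …, g_{n-1}⁻¹ g_n)`. -/
abbrev BObj (X : SimplexCategory) : Type := MulAction.orbitRel.Quotient Pi2 (EObj X)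

/-- The projection `Eπ → Bπ`. -/
def EB (X : SimplexCategory) (e : EObj X) : BObj X := Quotient.mk _ e

/-- The simplicial structure of `Bπ`. -/
def BMap {X Y : SimplexCategory} (θ : X ⟶ Y) : BObj Y → BObj X :=
  Quotient.map' (EMap θ) (by
    rintro a b ⟨g, rfl⟩
    exact ⟨g, rfl⟩)

lemma EB_smul (X : SimplexCategory) (g : Pi2) (e : EObj X) : EB X (g • e) = EB X e :=
  Quotient.sound ⟨g, rfl⟩

lemma BMap_EB {X Y : SimplexCategory} (θ : X ⟶ Y) (e : EObj Y) :
    BMap θ (EB Y e) = EB X (EMap θ e) := rfl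

/-- The simplicial module `F2[Bπ]`. -/
def KB : SMod.{0} where
  obj X := ModuleCat.of F2 (Lin (BObj X.unop))
  map f := ModuleCat.ofHom (Lin.map (BMap f.unop))
  map_id X := by
    ext : 1
    refine Lin.ext fun b => ?_
    induction b using Quotient.inductionOn with
    | h e => exact Lin.map_of _ _
  map_comp f g := by
    ext : 1
    refine Lin.ext fun b => ?_
    induction b using Quotient.inductionOn with
    | h e =>
      simp only [ModuleCat.hom_ofHom, ModuleCat.hom_comp, LinearMap.comp_apply, Lin.map_of]
      rfl

/-- The diagonal of `Bπ`, as a map of simplicial modules; it is induced from that of `Eπ`. -/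
def psiB : KB ⟶ tens KB KB where
  app X := ModuleCat.ofHom (diag (BObj X.unop))
  naturality X Y f := by
    ext : 1
    refine Lin.ext fun b => ?_
    change diag _ (Lin.map (BMap f.unop) (Lin.of b)) =
      TensorProduct.map (Lin.map (BMap f.unop)) (Lin.map (BMap f.unop)) (diag _ (Lin.of b))
    rw [Lin.map_of, diag_of, diag_of, TensorProduct.map_tmul, Lin.map_of]

/-! ## The coalgebra `W̄ = N F2[Bπ]` -/

/-- `W̄`, the normalized chains of `Bπ`. -/
abbrev Wbar (n : ℕ) : Type := NC KB n

instance (X : SimplexCategoryᵒᵖ) : Module.Finite F2 (KB.obj X) :=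
  inferInstanceAs (Module.Finite F2 (Lin (BObj X.unop)))

/-- The differential of `W̄`. -/
def Wbar.d (n : ℕ) : Wbar (n + 1) →ₗ[F2] Wbar n := NC.d KB n

/-- The components of the comultiplication of `W̄`: the Alexander-Whitney map after the
diagonal. -/
def Wbar.comul (p q n : ℕ) (h : n = p + q) : Wbar n →ₗ[F2] Wbar p ⊗[F2] Wbar q :=
  aw KB KB p q n h ∘ₗ NC.map psiB n

/-- The counit of `W̄`, induced by the augmentation of `F2[Bπ]` in degree zero. -/
def Wbar.counit : Wbar 0 →ₗ[F2] F2 :=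
  (degen KB 0).liftQ (Lin.lift fun _ : BObj ⦋0⦌ => (1 : F2)) bot_le

/-! ## Homotopy orbits `F2[Eπ] ⊗_π A ⊗ A` -/

/-- The action of the generator of `π` on `F2[Eπ_n] ⊗ (M ⊗ M)`: the diagonal action on `Eπ`
and the switch of the two factors `M`. -/
def swapAct (X : SimplexCategory) (M : Type u) [AddCommGroup M] [Module F2 M] :
    Lin (EObj X) ⊗[F2] (M ⊗[F2] M) →ₗ[F2] Lin (EObj X) ⊗[F2] (M ⊗[F2] M) :=
  TensorProduct.map (Lin.map fun e : EObj X => sig • e)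
    (TensorProduct.comm F2 M M).toLinearMap

/-- The submodule spanned by the elements `σ x - x`. -/
def orbRel (X : SimplexCategory) (M : Type u) [AddCommGroup M] [Module F2 M] :
    Submodule F2 (Lin (EObj X) ⊗[F2] (M ⊗[F2] M)) :=
  LinearMap.range (swapAct X M - LinearMap.id)

/-- `F2[Eπ_n] ⊗_π (M ⊗ M)`: the coinvariants of the diagonal action of the group `π` with two
elements, that is, the cokernel of `σ - 1`. -/
abbrev Orb (X : SimplexCategory) (M : Type u) [AddCommGroup M] [Module F2 M] : Type u :=
  (Lin (EObj X) ⊗[F2] (M ⊗[F2] M)) ⧸ orbRel X M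

section Orb

variable {M : Type u} [AddCommGroup M] [Module F2 M] {M₁ : Type v} [AddCommGroup M₁]
  [Module F2 M₁] {M₂ : Type w} [AddCommGroup M₂] [Module F2 M₂]

/-- The class `e ⊗ x ⊗ y` in the homotopy orbits. -/
def orbMk (X : SimplexCategory) (e : EObj X) (x y : M) : Orb X M :=
  (orbRel X M).mkQ (Lin.of e ⊗ₜ (x ⊗ₜ y))

lemma orb_rel (X : SimplexCategory) (e : EObj X) (x y : M) :
    orbMk X (sig • e) y x = orbMk X e x y := by
  unfold orbMk
  rw [← sub_eq_zero, ← map_sub, Submodule.mkQ_apply, Submodule.Quotient.mk_eq_zero]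
  refine ⟨Lin.of e ⊗ₜ (x ⊗ₜ y), ?_⟩
  simp [swapAct]

lemma pre_ext (X : SimplexCategory)
    {f g : Lin (EObj X) ⊗[F2] (M ⊗[F2] M) →ₗ[F2] M₂}
    (h : ∀ e x y, f (Lin.of e ⊗ₜ (x ⊗ₜ y)) = g (Lin.of e ⊗ₜ (x ⊗ₜ y))) :
    f = g := by
  apply TensorProduct.ext
  refine Lin.ext fun e => ?_
  apply TensorProduct.ext'
  intro x y
  exact h e x y

lemma orb_ext (X : SimplexCategory) {f g : Orb X M →ₗ[F2] M₂}
    (h : ∀ e x y, f (orbMk X e x y) = g (orbMk X e x y)) : f = g := by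
  apply Submodule.linearMap_qext
  exact pre_ext X h

/-- A map out of the homotopy orbits is a map that is invariant under the generator. -/
def orbLift (X : SimplexCategory) (f : Lin (EObj X) ⊗[F2] (M ⊗[F2] M) →ₗ[F2] M₂)
    (h : ∀ e x y, f (Lin.of (sig • e) ⊗ₜ (y ⊗ₜ x)) =
      f (Lin.of e ⊗ₜ (x ⊗ₜ y))) : Orb X M →ₗ[F2] M₂ :=
  (orbRel X M).liftQ f (by
    have : f ∘ₗ swapAct X M = f := pre_ext X fun e x y => by
      simpa [swapAct] using h e x y
    rintro _ ⟨z, rfl⟩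
    rw [LinearMap.mem_ker, LinearMap.sub_apply, map_sub]
    have := LinearMap.congr_fun this z
    simp only [LinearMap.comp_apply] at this
    rw [this]
    simp)

@[simp]
lemma orbLift_mk (X : SimplexCategory) (f : Lin (EObj X) ⊗[F2] (M ⊗[F2] M) →ₗ[F2] M₂)
    (h) (e : EObj X) (x y : M) :
    orbLift X f h (orbMk X e x y) = f (Lin.of e ⊗ₜ (x ⊗ₜ y)) := rfl

/-- The map `e ⊗ x ⊗ y ↦ θ^* e ⊗ f x ⊗ f y`. -/
def orbMap {X Y : SimplexCategory} (θ : X ⟶ Y) (f : M →ₗ[F2] M₁) :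
    Orb Y M →ₗ[F2] Orb X M₁ :=
  orbLift Y ((orbRel X M₁).mkQ ∘ₗ
    TensorProduct.map (Lin.map (EMap θ)) (TensorProduct.map f f))
    (fun e x y => by
      simp only [LinearMap.comp_apply, TensorProduct.map_tmul, Lin.map_of]
      exact orb_rel X (EMap θ e) (f x) (f y))

@[simp]
lemma orbMap_mk {X Y : SimplexCategory} (θ : X ⟶ Y) (f : M →ₗ[F2] M₁) (e : EObj Y) (x y : M) :
    orbMap θ f (orbMk Y e x y) = orbMk X (EMap θ e) (f x) (f y) := by
  rw [orbMap, orbLift_mk, LinearMap.comp_apply, TensorProduct.map_tmul, TensorProduct.map_tmul,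
    Lin.map_of]
  rfl

lemma orbMap_id (X : SimplexCategory) :
    orbMap (𝟙 X) (LinearMap.id : M →ₗ[F2] M) = LinearMap.id :=
  orb_ext X fun e x y => by rw [orbMap_mk]; rfl

lemma orbMap_orbMap {X Y Z : SimplexCategory} (θ : X ⟶ Y) (η : Y ⟶ Z) (f : M →ₗ[F2] M₁)
    (g : M₁ →ₗ[F2] M₂) : orbMap θ g ∘ₗ orbMap η f = orbMap (θ ≫ η) (g ∘ₗ f) :=
  orb_ext Z fun e x y => by rw [LinearMap.comp_apply, orbMap_mk, orbMap_mk, orbMap_mk]; rfl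

/-- The coaction `e ⊗ z ↦ ē ⊗ (e ⊗ z)` on the homotopy orbits in a fixed degree: apply the
diagonal of `Eπ`, then project the left factor to `Bπ` and the right one to the orbits. -/
def orbCoact (X : SimplexCategory) : Orb X M →ₗ[F2] Lin (BObj X) ⊗[F2] Orb X M :=
  orbLift X
    (TensorProduct.map (Lin.map (EB X)) (orbRel X M).mkQ ∘ₗ
      (TensorProduct.assoc F2 (Lin (EObj X)) (Lin (EObj X)) (M ⊗[F2] M)).toLinearMap ∘ₗ
      LinearMap.rTensor (M ⊗[F2] M) (diag (EObj X)))
    (fun e x y => by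
      simp only [LinearMap.comp_apply, diag_of, LinearMap.rTensor_tmul,
        LinearEquiv.coe_coe, TensorProduct.assoc_tmul, TensorProduct.map_tmul, Lin.map_of,
        EB_smul]
      congr 1
      exact orb_rel X e x y)

@[simp]
lemma orbCoact_mk (X : SimplexCategory) (e : EObj X) (x y : M) :
    orbCoact X (orbMk X e x y) = Lin.of (EB X e) ⊗ₜ orbMk X e x y := by
  rw [orbCoact, orbLift_mk, LinearMap.comp_apply, LinearMap.comp_apply, LinearMap.rTensor_tmul,
    diag_of, LinearEquiv.coe_coe, TensorProduct.assoc_tmul, TensorProduct.map_tmul, Lin.map_of]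
  rfl

lemma orbCoact_orbMap {X Y : SimplexCategory} (θ : X ⟶ Y) (f : M →ₗ[F2] M₁) :
    orbCoact X ∘ₗ orbMap θ f =
      TensorProduct.map (Lin.map (BMap θ)) (orbMap θ f) ∘ₗ orbCoact Y :=
  orb_ext Y fun e x y => by
    rw [LinearMap.comp_apply, LinearMap.comp_apply, orbMap_mk, orbCoact_mk, orbCoact_mk,
      TensorProduct.map_tmul, Lin.map_of, orbMap_mk, BMap_EB]

end Orb

/-- The simplicial module `F2[Eπ] ⊗_π (A ⊗ A)`. -/
def hOrb (A : SMod.{u}) : SMod.{u} where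
  obj X := ModuleCat.of F2 (Orb X.unop (A.obj X))
  map f := ModuleCat.ofHom (orbMap f.unop (A.map f).hom)
  map_id X := by
    rw [A.map_id]
    exact ModuleCat.hom_ext (orbMap_id X.unop)
  map_comp f g := by
    rw [A.map_comp]
    exact ModuleCat.hom_ext (orbMap_orbMap g.unop f.unop (A.map f).hom (A.map g).hom).symm

/-- Functoriality of `F2[Eπ] ⊗_π (A ⊗ A)`. -/
def hOrbMap {A B : SMod.{u}} (g : A ⟶ B) : hOrb A ⟶ hOrb B where
  app X := ModuleCat.ofHom (orbMap (𝟙 X.unop) (g.app X).hom)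
  naturality X Y f := by
    have h := congrArg ModuleCat.Hom.hom (g.naturality f)
    simp only [ModuleCat.hom_comp] at h
    apply ModuleCat.hom_ext
    refine (orbMap_orbMap (𝟙 Y.unop) f.unop (A.map f).hom (g.app Y).hom).trans ?_
    refine Eq.trans ?_ (orbMap_orbMap f.unop (𝟙 X.unop) (g.app X).hom (B.map f).hom).symm
    rw [h, Category.id_comp, Category.comp_id]

/-- The functor `A ↦ F2[Eπ] ⊗_π (A ⊗ A)` on simplicial modules. -/
def hOrbFunctor : SMod.{u} ⥤ SMod.{u} where
  obj := hOrb
  map := hOrbMap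
  map_id A := by
    refine NatTrans.ext (funext fun X => ?_)
    exact ModuleCat.hom_ext (orbMap_id X.unop)
  map_comp f g := by
    refine NatTrans.ext (funext fun X => ?_)
    apply ModuleCat.hom_ext
    refine Eq.trans ?_
      (orbMap_orbMap (𝟙 X.unop) (𝟙 X.unop) (f.app X).hom (g.app X).hom).symm
    rw [Category.comp_id]
    rfl

/-- The cosimplicial simplicial module `F2[Eπ] ⊗_π (V ⊗ V)`, formed in each cosimplicial
degree. -/
def hOrbCos (V : CSMod.{u}) : CSMod.{u} :=
  V ⋙ hOrbFunctor

/-- The coaction of `F2[Bπ]` on the homotopy orbits, a map of simplicial modules. -/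
def rho1 (A : SMod.{u}) : hOrb A ⟶ tens KB (hOrb A) where
  app X := ModuleCat.ofHom (orbCoact X.unop)
  naturality X Y f := ModuleCat.hom_ext (orbCoact_orbMap f.unop (A.map f).hom)

/-- The components `N_n → W̄_r ⊗ N_s` of the coaction on `N(F2[Eπ] ⊗_π (A ⊗ A))`: the
Alexander-Whitney map after the coaction of `F2[Bπ]`. -/
def rho2 (A : SMod.{u}) (r s n : ℕ) (h : n = r + s) :
    NC (hOrb A) n →ₗ[F2] Wbar r ⊗[F2] NC (hOrb A) s :=
  aw KB (hOrb A) r s n h ∘ₗ NC.map (rho1 A) n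

lemma rho2_natural {A B : SMod.{u}} (g : A ⟶ B) (r s n : ℕ) (h : n = r + s)
    (x : NC (hOrb A) n) :
    rho2 B r s n h (NC.map (hOrbMap g) n x) =
      LinearMap.lTensor (Wbar r) (NC.map (hOrbMap g) s) (rho2 A r s n h x) := by
  obtain ⟨x, rfl⟩ := Submodule.mkQ_surjective _ x
  have h1 := LinearMap.congr_fun (orbCoact_orbMap (𝟙 ⦋n⦌) (g.app (op ⦋n⦌)).hom) x
  have h2 : Lin.map (BMap (𝟙 ⦋n⦌)) = LinearMap.id := Lin.ext fun b => by
    induction b using Quotient.inductionOn with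
    | h e => exact Lin.map_of _ _
  rw [h2] at h1
  have h3 := LinearMap.congr_fun (awPre_natural KB (hOrbMap g) r s n h) (orbCoact ⦋n⦌ x)
  exact (congrArg (awPre KB (hOrb B) r s n h) h1).trans h3

/-! ## Totalization -/

/-- `(Tot V)_q` for `q = [X]`: families of maps of simplicial sets `Δ^p × Δ^q → V^p` that are
compatible with the cosimplicial structure. -/
def totSub (V : CSMod.{u}) (X : SimplexCategory) : Submodule F2
    (∀ p n : SimplexCategory, (n ⟶ p) → (n ⟶ X) → (V.obj p).obj (op n)) where
  carrier := {f |
    (∀ (p m n : SimplexCategory) (θ : m ⟶ n) (a : n ⟶ p) (b : n ⟶ X),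
      act (V.obj p) θ (f p n a b) = f p m (θ ≫ a) (θ ≫ b)) ∧
    (∀ (p p' n : SimplexCategory) (α : p ⟶ p') (a : n ⟶ p) (b : n ⟶ X),
      ((V.map α).app (op n)).hom (f p n a b) = f p' n (a ≫ α) b)}
  add_mem' {f g} hf hg :=
    ⟨fun p m n θ a b => by simp [hf.1, hg.1], fun p p' n α a b => by simp [hf.2, hg.2]⟩
  zero_mem' := ⟨fun p m n θ a b => by simp, fun p p' n α a b => by simp⟩
  smul_mem' c f hf :=
    ⟨fun p m n θ a b => by simp [hf.1], fun p p' n α a b => by simp [hf.2]⟩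

/-- The simplicial module `Tot V`. -/
def tot (V : CSMod.{u}) : SMod.{u} where
  obj X := ModuleCat.of F2 (totSub V X.unop)
  map {X Y} β := ModuleCat.ofHom
    { toFun := fun f => ⟨fun p n a b => f.1 p n a (b ≫ β.unop),
        fun p m n θ a b => by simp [f.2.1], fun p p' n α a b => by simp [f.2.2]⟩
      map_add' := fun _ _ => rfl
      map_smul' := fun _ _ => rfl }
  map_id X := by
    apply ModuleCat.hom_ext
    refine LinearMap.ext fun f => Subtype.ext ?_
    funext p n a b
    simp
  map_comp f g := by
    apply ModuleCat.hom_ext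
    refine LinearMap.ext fun f => Subtype.ext ?_
    funext p n a b
    simp

/-- Evaluation of an element of `(Tot V)_q` at a simplex `(a, b)` of `Δ^p × Δ^q`. -/
def totEv (V : CSMod.{u}) (X p n : SimplexCategory) (a : n ⟶ p) (b : n ⟶ X) :
    (tot V).obj (op X) →ₗ[F2] (V.obj p).obj (op n) where
  toFun f := Subtype.val (p := (· ∈ totSub V X)) f p n a b
  map_add' _ _ := rfl
  map_smul' _ _ := rfl

lemma act_totEv (V : CSMod.{u}) (X p : SimplexCategory) {m n : SimplexCategory} (θ : m ⟶ n)
    (a : n ⟶ p) (b : n ⟶ X) :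
    act (V.obj p) θ ∘ₗ totEv V X p n a b = totEv V X p m (θ ≫ a) (θ ≫ b) :=
  LinearMap.ext fun f => (Subtype.property (p := (· ∈ totSub V X)) f).1 p m n θ a b

lemma app_totEv (V : CSMod.{u}) (X n : SimplexCategory) {p p' : SimplexCategory} (α : p ⟶ p')
    (a : n ⟶ p) (b : n ⟶ X) :
    ((V.map α).app (op n)).hom ∘ₗ totEv V X p n a b = totEv V X p' n (a ≫ α) b :=
  LinearMap.ext fun f => (Subtype.property (p := (· ∈ totSub V X)) f).2 p p' n α a b

lemma totEv_act (V : CSMod.{u}) {X Y : SimplexCategory} (β : Y ⟶ X) (p n : SimplexCategory)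
    (a : n ⟶ p) (b : n ⟶ Y) :
    totEv V Y p n a b ∘ₗ act (tot V) β = totEv V X p n a (b ≫ β) := rfl

/-- The algebraic interchange map in simplicial degree `q = [X]`: the class of `e ⊗ f ⊗ g` is
sent to `(a, b) ↦ e(b) ⊗ f(a, b) ⊗ g(a, b)`. -/
def interObj (V : CSMod.{u}) (X : SimplexCategory) :
    Orb X ((tot V).obj (op X)) →ₗ[F2] totSub (hOrbCos V) X :=
  LinearMap.codRestrict (totSub (hOrbCos V) X)
    (LinearMap.pi fun p => LinearMap.pi fun n => LinearMap.pi fun a => LinearMap.pi fun b =>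
      orbMap b (totEv V X p n a b))
    (fun z => by
      constructor
      · intro p m n θ a b
        have h := LinearMap.congr_fun
          (orbMap_orbMap θ b (totEv V X p n a b) (act (V.obj p) θ)) z
        rw [act_totEv] at h
        exact h
      · intro p p' n α a b
        have h := LinearMap.congr_fun
          (orbMap_orbMap (𝟙 n) b (totEv V X p n a b) ((V.map α).app (op n)).hom) z
        rw [app_totEv, Category.id_comp] at h
        exact h)

/-- The algebraic interchange map `F2[Eπ] ⊗_π (Tot V)^{⊗2} → Tot (F2[Eπ] ⊗_π V^{⊗2})`. -/
def interchange (V : CSMod.{u}) : hOrb (tot V) ⟶ tot (hOrbCos V) where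
  app X := ModuleCat.ofHom (interObj V X.unop)
  naturality X Y β := by
    apply ModuleCat.hom_ext
    refine LinearMap.ext fun z => Subtype.ext ?_
    funext p n a b
    have h := LinearMap.congr_fun (orbMap_orbMap b β.unop (act (tot V) β.unop)
      (totEv V Y.unop p n a b)) z
    rw [totEv_act] at h
    exact h

/-! ## The double complex `CN V` and its product total complex -/

/-- The submodule of `N_s(V^k)` spanned by the images of the cofaces `d^1, …, d^k`. -/
def coface (V : CSMod.{u}) (k s : ℕ) : Submodule F2 (NC (V.obj ⦋k⦌) s) :=
  match k with
  | 0 => ⊥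
  | k + 1 => ⨆ j : Fin (k + 1), LinearMap.range (NC.map (V.map (SimplexCategory.δ j.succ)) s)

/-- `C^k N_s V`, in bidegree `(-k, s)`: the conormalization of the cosimplicial chain complex
`N V`, a quotient by the images of `d^1, …, d^k`. -/
abbrev CN (V : CSMod.{u}) (k s : ℕ) : Type u := NC (V.obj ⦋k⦌) s ⧸ coface V k s

/-- The vertical differential of `CN V`, induced by the differential of the normalized chains. -/
def CN.dv (V : CSMod.{u}) (k s : ℕ) : CN V k (s + 1) →ₗ[F2] CN V k s :=
  (coface V k (s + 1)).mapQ (coface V k s) (NC.d (V.obj ⦋k⦌) s) (by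
    cases k with
    | zero => exact bot_le
    | succ k =>
      refine iSup_le fun j => ?_
      rintro _ ⟨x, rfl⟩
      rw [Submodule.mem_comap, NC.d_map]
      exact Submodule.mem_iSup_of_mem j ⟨_, rfl⟩)

/-- The horizontal differential of `CN V`, induced by the alternating sum of the cofaces. It is
induced by `d^0`, since the other cofaces vanish in the quotient. -/
def CN.dh (V : CSMod.{u}) (k s : ℕ) : CN V k s →ₗ[F2] CN V (k + 1) s :=
  (coface V k s).mapQ (coface V (k + 1) s) (NC.map (V.map (SimplexCategory.δ 0)) s) (by
    cases k with
    | zero => exact bot_le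
    | succ k =>
      refine iSup_le fun j => ?_
      rintro _ ⟨x, rfl⟩
      have e : SimplexCategory.δ j.succ ≫ SimplexCategory.δ 0 =
          SimplexCategory.δ 0 ≫ SimplexCategory.δ j.succ.succ :=
        (SimplexCategory.δ_comp_δ (Fin.zero_le j.succ)).symm
      rw [Submodule.mem_comap, ← NC.map_comp, ← V.map_comp, e, V.map_comp,
        NC.map_comp]
      exact Submodule.mem_iSup_of_mem j.succ ⟨_, rfl⟩)

/-- The bidegrees `(-k, s)` of total degree `i = s - k`. -/
abbrev TIdx (i : ℤ) : Type := {ks : ℕ × ℕ // (ks.2 : ℤ) = i + ks.1}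

/-- The product total complex of `CN V` in degree `i`. -/
abbrev TCN (V : CSMod.{u}) (i : ℤ) : Type u := ∀ ks : TIdx i, CN V ks.1.1 ks.1.2

/-- The total differential, the sum of the vertical and the horizontal one. -/
def TCN.d (V : CSMod.{u}) (i j : ℤ) (h : i = j + 1) : TCN V i →ₗ[F2] TCN V j :=
  LinearMap.pi fun ks => match ks with
    | ⟨(0, s), hs⟩ =>
      CN.dv V 0 s ∘ₗ LinearMap.proj (⟨(0, s + 1), by push_cast at hs ⊢; omega⟩ : TIdx i)
    | ⟨(k + 1, s), hs⟩ =>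
      CN.dv V (k + 1) s ∘ₗ
          LinearMap.proj (⟨(k + 1, s + 1), by push_cast at hs ⊢; omega⟩ : TIdx i) +
        CN.dh V k s ∘ₗ LinearMap.proj (⟨(k, s), by push_cast at hs ⊢; omega⟩ : TIdx i)

/-! ## The map `φ_∞ : N Tot V → TCN V` -/

/-- The `(k, n - k)`-shuffles, given by the subsets `S` of the set `{0, …, n - 1}` of steps with
`k` elements (the values of the shuffle on `0, …, k - 1`). -/
abbrev Shuffle (k n : ℕ) : Type := {S : Finset (Fin n) // S.card = k}

/-- The surjection `[n] → [k]` which increases exactly at the steps in `S`; it is the iterated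
degeneracy `s_{τ(n-1)} ⋯ s_{τ(k)}` of the top simplex of `Δ^k`. -/
def stepMap {k n : ℕ} (S : Finset (Fin n)) (hS : S.card = k) : ⦋n⦌ ⟶ ⦋k⦌ :=
  SimplexCategory.Hom.mk
    ⟨fun i => ⟨(S.filter fun j => j.castSucc < i).card, by
        have := Finset.card_filter_le S fun j => j.castSucc < i
        simp; omega⟩,
      fun i i' h => by
        rw [Fin.le_def]
        exact Finset.card_le_card fun j hj => by
          simp only [Finset.mem_filter] at hj ⊢
          exact ⟨hj.1, lt_of_lt_of_le hj.2 h⟩⟩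

lemma stepMap_castSucc {k n : ℕ} (S : Finset (Fin (n + 1))) (hS : S.card = k) (j : Fin (n + 1))
    (hj : j ∉ S) :
    (stepMap S hS).toOrderHom j.castSucc = (stepMap S hS).toOrderHom j.succ := by
  rw [Fin.ext_iff]
  change (S.filter fun l => l.castSucc < j.castSucc).card =
    (S.filter fun l => l.castSucc < j.succ).card
  congr 1
  ext l
  simp only [Finset.mem_filter, Fin.lt_def, Fin.val_castSucc, Fin.val_succ]
  refine and_congr_right fun hl => ?_
  have : (l : ℕ) ≠ j := fun h => hj (Fin.ext h ▸ hl)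
  omega

lemma card_compl_shuffle {k q n : ℕ} (h : n = q + k) (S : Shuffle k n) : (S.1ᶜ).card = q := by
  rw [Finset.card_compl, S.2, Fintype.card_fin]; omega

/-- The value of `f : Δ^k × Δ^q → V^k` on the shuffle product `ι_k ∧ ι_q` of the top simplices. -/
def shufEv (V : CSMod.{u}) (k q n : ℕ) (h : n = q + k) :
    (tot V) _⦋q⦌ →ₗ[F2] (V.obj ⦋k⦌) _⦋n⦌ :=
  ∑ S : Shuffle k n,
    totEv V ⦋q⦌ ⦋k⦌ ⦋n⦌ (stepMap S.1 S.2) (stepMap S.1ᶜ (card_compl_shuffle h S))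

lemma shufEv_degen (V : CSMod.{u}) (k q n : ℕ) (h : n = q + k) :
    degen (tot V) q ≤ (degen (V.obj ⦋k⦌) n).comap (shufEv V k q n h) := by
  refine degen_le _ _ _ fun m θ hm f => ?_
  rw [Submodule.mem_comap, shufEv, LinearMap.sum_apply]
  refine Submodule.sum_mem _ fun S _ => ?_
  have hS := LinearMap.congr_fun (totEv_act V θ ⦋k⦌ ⦋n⦌ (stepMap S.1 S.2)
    (stepMap S.1ᶜ (card_compl_shuffle h S))) f
  rw [LinearMap.comp_apply] at hS
  rw [hS]
  set a := stepMap S.1 S.2 with ha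
  set b := stepMap S.1ᶜ (card_compl_shuffle h S) with hb
  obtain ⟨n, rfl⟩ : ∃ n', n = n' + 1 := ⟨n - 1, by omega⟩
  -- there is a step on which both maps are constant
  have hj : ∃ j : Fin (n + 1), a.toOrderHom j.castSucc = a.toOrderHom j.succ ∧
      (b ≫ θ).toOrderHom j.castSucc = (b ≫ θ).toOrderHom j.succ := by
    by_contra! hc
    have hs : StrictMono (fun i : Fin (n + 1 + 1) =>
        ((a.toOrderHom i : Fin (k + 1)) : ℕ) + (((b ≫ θ).toOrderHom i : Fin (m + 1)) : ℕ)) := by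
      rw [Fin.strictMono_iff_lt_succ]
      intro i
      have h1 : ((a.toOrderHom i.castSucc : Fin (k + 1)) : ℕ) ≤ (a.toOrderHom i.succ : Fin (k + 1)) :=
        a.toOrderHom.monotone (by simp [Fin.le_def])
      have h2 : (((b ≫ θ).toOrderHom i.castSucc : Fin (m + 1)) : ℕ) ≤
          ((b ≫ θ).toOrderHom i.succ : Fin (m + 1)) :=
        (b ≫ θ).toOrderHom.monotone (by simp [Fin.le_def])
      by_cases h3 : a.toOrderHom i.castSucc = a.toOrderHom i.succ
      · have h4 := hc i h3
        rw [Ne, Fin.ext_iff] at h4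
        change _ + _ < _ + _
        omega
      · rw [Fin.ext_iff] at h3
        change _ + _ < _ + _
        omega
    have hr : ∀ i : Fin (n + 1 + 1), ((a.toOrderHom i : Fin (k + 1)) : ℕ) +
        (((b ≫ θ).toOrderHom i : Fin (m + 1)) : ℕ) < k + m + 1 := by
      intro i
      have h1 : ((a.toOrderHom i : Fin (k + 1)) : ℕ) < k + 1 := Fin.isLt _
      have h2 : (((b ≫ θ).toOrderHom i : Fin (m + 1)) : ℕ) < m + 1 := Fin.isLt _
      omega
    have := Fintype.card_le_of_injective
      (fun i : Fin (n + 1 + 1) => (⟨_, hr i⟩ : Fin (k + m + 1)))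
      (fun i i' hii => hs.injective (by simpa using hii))
    simp at this
    omega
  obtain ⟨j, h1, h2⟩ := hj
  rw [factor_of_eq a j h1, factor_of_eq (b ≫ θ) j h2, ← act_totEv]
  exact Submodule.mem_iSup_of_mem j ⟨_, rfl⟩

/-- The component of `φ_∞` in `C^k N_{q+k} V`: the class of `f^k(ι_k ∧ ι_q)`. -/
def phiComp (V : CSMod.{u}) (k q n : ℕ) (h : n = q + k) : NC (tot V) q →ₗ[F2] CN V k n :=
  (coface V k n).mkQ ∘ₗ
    (degen (tot V) q).mapQ (degen (V.obj ⦋k⦌) n) (shufEv V k q n h) (shufEv_degen V k q n h)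

/-- The map `φ_∞ : N_q (Tot V) → (TCN V)_q`. -/
def phi (V : CSMod.{u}) (q : ℕ) : NC (tot V) q →ₗ[F2] TCN V (q : ℤ) :=
  LinearMap.pi fun ks => phiComp V ks.1.1 q ks.1.2 (by have := ks.2; omega)

/-! ## The coaction on `TCN (F2[Eπ] ⊗_π V^{⊗2})` -/

/-- The coaction in a fixed cosimplicial degree, passed to the conormalization. The constant
cosimplicial complex `W̄` has conormalization `W̄` concentrated in cosimplicial degree zero; the
shuffle map `C^k(W̄ ⊗ Y) → C^0(W̄) ⊗ C^k(Y)` is the sum over the unique `(0, k)`-shuffle and so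
sends the class of `w ⊗ y` to `w` tensor the class of `y`. -/
def rhoCN (V : CSMod.{u}) (k r s n : ℕ) (h : n = r + s) :
    CN (hOrbCos V) k n →ₗ[F2] Wbar r ⊗[F2] CN (hOrbCos V) k s :=
  (coface (hOrbCos V) k n).liftQ
    (LinearMap.lTensor (Wbar r) (coface (hOrbCos V) k s).mkQ ∘ₗ rho2 (V.obj ⦋k⦌) r s n h) (by
    cases k with
    | zero => exact bot_le
    | succ k =>
      refine iSup_le fun j => ?_
      rintro _ ⟨x, rfl⟩
      rw [LinearMap.mem_ker]
      have h1 := rho2_natural (V.map (SimplexCategory.δ j.succ)) r s n h x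
      have h2 : (coface (hOrbCos V) (k + 1) s).mkQ ∘ₗ NC.map (hOrbMap (V.map (SimplexCategory.δ j.succ))) s = 0 := by
        refine LinearMap.ext fun y => (Submodule.Quotient.mk_eq_zero _).2 ?_
        change _ ∈ ⨆ j : Fin (k + 1),
          LinearMap.range (NC.map ((hOrbCos V).map (SimplexCategory.δ j.succ)) s)
        exact Submodule.mem_iSup_of_mem j ⟨y, rfl⟩
      have h3 := LinearMap.congr_fun (LinearMap.lTensor_comp (Wbar r)
        (coface (hOrbCos V) (k + 1) s).mkQ (NC.map (hOrbMap (V.map (SimplexCategory.δ j.succ))) s))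
        (rho2 (V.obj ⦋k⦌) r s n h x)
      rw [h2, LinearMap.lTensor_zero, LinearMap.zero_apply] at h3
      exact (congrArg (LinearMap.lTensor (Wbar r) (coface (hOrbCos V) (k + 1) s).mkQ) h1).trans
        h3.symm)

/-- For a finite dimensional `W`, tensoring with `W` commutes with arbitrary products. The map
is the canonical one from left to right. -/
def tensorPi (W : Type v) [AddCommGroup W] [Module F2 W] [Module.Finite F2 W] {ι : Type w}
    (M : ι → Type u) [∀ i, AddCommGroup (M i)] [∀ i, Module F2 (M i)] :
    W ⊗[F2] (∀ i, M i) ≃ₗ[F2] ∀ i, W ⊗[F2] M i :=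
  LinearEquiv.ofLinearMap
    (LinearMap.pi fun i => LinearMap.lTensor W (LinearMap.proj i))
    (∑ j, TensorProduct.mk F2 W (∀ i, M i) (Module.finBasis F2 W j) ∘ₗ
      LinearMap.pi fun i => (TensorProduct.lid F2 (M i)).toLinearMap ∘ₗ
        LinearMap.rTensor (M i) ((Module.finBasis F2 W).coord j) ∘ₗ LinearMap.proj i)
    (by
      refine LinearMap.ext fun y => funext fun i => ?_
      have key : (∑ j, TensorProduct.mk F2 W (M i) (Module.finBasis F2 W j) ∘ₗ
          (TensorProduct.lid F2 (M i)).toLinearMap ∘ₗ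
          LinearMap.rTensor (M i) ((Module.finBasis F2 W).coord j)) = LinearMap.id := by
        apply TensorProduct.ext'
        intro a b
        simp only [LinearMap.sum_apply, LinearMap.comp_apply, LinearMap.rTensor_tmul,
          LinearEquiv.coe_coe, TensorProduct.lid_tmul, TensorProduct.mk_apply,
          TensorProduct.tmul_smul, TensorProduct.smul_tmul', LinearMap.id_apply,
          ← TensorProduct.sum_tmul]
        congr 1
        exact (Module.finBasis F2 W).sum_repr a
      have := LinearMap.congr_fun key (y i)
      simpa using this)
    (by
      apply TensorProduct.ext'
      intro a b
      have : ∀ j, (LinearMap.pi fun i => (TensorProduct.lid F2 (M i)).toLinearMap ∘ₗ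
          LinearMap.rTensor (M i) ((Module.finBasis F2 W).coord j) ∘ₗ LinearMap.proj i)
          ((LinearMap.pi fun i => LinearMap.lTensor W (LinearMap.proj i)) (a ⊗ₜ[F2] b)) =
          (Module.finBasis F2 W).coord j a • b := by
        intro j
        funext i
        simp
      simp only [LinearMap.comp_apply, LinearMap.sum_apply, this, TensorProduct.mk_apply,
        LinearMap.id_apply, TensorProduct.tmul_smul, TensorProduct.smul_tmul',
        ← TensorProduct.sum_tmul]
      congr 1
      exact (Module.finBasis F2 W).sum_repr a)

/-- The components `(TCN)_n → W̄_r ⊗ (TCN)_i`, `n = r + i`, of the coaction on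
`TCN (F2[Eπ] ⊗_π V^{⊗2})`. The component in bidegree `(-k, s)` is the coaction of `W̄` on the
normalized chains in cosimplicial degree `k`. -/
def rho3 (V : CSMod.{u}) (r : ℕ) (i n : ℤ) (h : n = (r : ℤ) + i) :
    TCN (hOrbCos V) n →ₗ[F2] Wbar r ⊗[F2] TCN (hOrbCos V) i :=
  (tensorPi (Wbar r) fun ks : TIdx i => CN (hOrbCos V) ks.1.1 ks.1.2).symm.toLinearMap ∘ₗ
    LinearMap.pi fun ks => rhoCN V ks.1.1 r ks.1.2 (r + ks.1.2) rfl ∘ₗ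
      LinearMap.proj (⟨(ks.1.1, r + ks.1.2), by
        have := ks.2
        push_cast
        omega⟩ : TIdx n)

/-! ## Differential graded coalgebras, comodules and their maps -/

/-- `W` with differential `d`, comultiplication with components `Δ_{p,q} : W_{p+q} → W_p ⊗ W_q`
and counit `ε` is a differential graded coalgebra over `F2`, concentrated in degrees `≥ 0`. -/
structure IsDGCoalgebra (W : ℕ → Type v) [∀ n, AddCommGroup (W n)] [∀ n, Module F2 (W n)]
    (d : ∀ n, W (n + 1) →ₗ[F2] W n)
    (Δ : ∀ p q n : ℕ, n = p + q → (W n →ₗ[F2] W p ⊗[F2] W q))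
    (ε : W 0 →ₗ[F2] F2) : Prop where
  d_comp_d : ∀ (n : ℕ) (x : W (n + 2)), d n (d (n + 1) x) = 0
  counit_d : ∀ x : W 1, ε (d 0 x) = 0
  comul_d : ∀ (p q n : ℕ) (h : n = p + q) (x : W (n + 1)),
    Δ p q n h (d n x) =
      LinearMap.rTensor (W q) (d p) (Δ (p + 1) q (n + 1) (by omega) x) +
        LinearMap.lTensor (W p) (d q) (Δ p (q + 1) (n + 1) (by omega) x)
  coassoc : ∀ (p q r n : ℕ) (h : n = p + q + r) (x : W n),
    TensorProduct.assoc F2 (W p) (W q) (W r)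
        (LinearMap.rTensor (W r) (Δ p q (p + q) rfl) (Δ (p + q) r n h x)) =
      LinearMap.lTensor (W p) (Δ q r (q + r) rfl) (Δ p (q + r) n (by omega) x)
  counit_left : ∀ (n : ℕ) (x : W n),
    TensorProduct.lid F2 (W n) (LinearMap.rTensor (W n) ε (Δ 0 n n (by omega) x)) = x
  counit_right : ∀ (n : ℕ) (x : W n),
    TensorProduct.rid F2 (W n) (LinearMap.lTensor (W n) ε (Δ n 0 n (by omega) x)) = x

/-- `M`, graded by `I` (which is `ℕ` or `ℤ`), with differential `d` and coaction with components
`ρ_{r,i} : M_{r+i} → W_r ⊗ M_i`, is a differential graded left comodule over `W`. The coaction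
takes values in the completed tensor product, with `∏_r W_r ⊗ M_{n-r}` in degree `n`; for
`I = ℕ` the product is finite, and this is the tensor product of graded modules. -/
structure IsDGComodule (W : ℕ → Type v) [∀ n, AddCommGroup (W n)] [∀ n, Module F2 (W n)]
    (dW : ∀ n, W (n + 1) →ₗ[F2] W n)
    (Δ : ∀ p q n : ℕ, n = p + q → (W n →ₗ[F2] W p ⊗[F2] W q))
    (ε : W 0 →ₗ[F2] F2)
    {I : Type} [AddCommMonoidWithOne I]
    (M : I → Type u) [∀ i, AddCommGroup (M i)] [∀ i, Module F2 (M i)]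
    (d : ∀ i j : I, i = j + 1 → (M i →ₗ[F2] M j))
    (ρ : ∀ (r : ℕ) (i n : I), n = (r : I) + i → (M n →ₗ[F2] W r ⊗[F2] M i)) : Prop where
  d_comp_d : ∀ (i j k : I) (hi : i = j + 1) (hj : j = k + 1) (x : M i),
    d j k hj (d i j hi x) = 0
  coact_d : ∀ (r : ℕ) (i i' n n' : I) (hi : i' = i + 1) (hn : n' = n + 1)
      (h : n = (r : I) + i) (h₁ : n' = ((r + 1 : ℕ) : I) + i) (h₂ : n' = (r : I) + i')
      (x : M n'),
    ρ r i n h (d n' n hn x) =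
      LinearMap.rTensor (M i) (dW r) (ρ (r + 1) i n' h₁ x) +
        LinearMap.lTensor (W r) (d i' i hi) (ρ r i' n' h₂ x)
  coassoc : ∀ (p q : ℕ) (i j n : I) (h : n = ((p + q : ℕ) : I) + i) (hj : j = (q : I) + i)
      (hn : n = (p : I) + j) (x : M n),
    TensorProduct.assoc F2 (W p) (W q) (M i)
        (LinearMap.rTensor (M i) (Δ p q (p + q) rfl) (ρ (p + q) i n h x)) =
      LinearMap.lTensor (W p) (ρ q i j hj) (ρ p j n hn x)
  counit : ∀ (i : I) (h : i = ((0 : ℕ) : I) + i) (x : M i),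
    TensorProduct.lid F2 (M i) (LinearMap.rTensor (M i) ε (ρ 0 i i h x)) = x

/-- `Φ` is a map of differential graded comodules over `W` from `M`, which is concentrated in
degrees `≥ 0`, to `M'`, which may be nonzero in all integral degrees: it commutes with the
differentials and with the coactions. The conditions with indices below zero say that the
respective components vanish, since `M` is zero there. -/
structure IsDGComoduleMap (W : ℕ → Type v) [∀ n, AddCommGroup (W n)] [∀ n, Module F2 (W n)]
    (M : ℕ → Type u) [∀ i, AddCommGroup (M i)] [∀ i, Module F2 (M i)]
    (d : ∀ i j : ℕ, i = j + 1 → (M i →ₗ[F2] M j))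
    (ρ : ∀ r i n : ℕ, n = r + i → (M n →ₗ[F2] W r ⊗[F2] M i))
    (M' : ℤ → Type w) [∀ i, AddCommGroup (M' i)] [∀ i, Module F2 (M' i)]
    (d' : ∀ i j : ℤ, i = j + 1 → (M' i →ₗ[F2] M' j))
    (ρ' : ∀ (r : ℕ) (i n : ℤ), n = (r : ℤ) + i → (M' n →ₗ[F2] W r ⊗[F2] M' i))
    (Φ : ∀ n : ℕ, M n →ₗ[F2] M' (n : ℤ)) : Prop where
  map_d : ∀ (n m : ℕ) (h : n = m + 1) (h' : (n : ℤ) = (m : ℤ) + 1) (x : M n),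
    d' n m h' (Φ n x) = Φ m (d n m h x)
  map_d_zero : ∀ (j : ℤ) (h : ((0 : ℕ) : ℤ) = j + 1) (x : M 0), d' (0 : ℕ) j h (Φ 0 x) = 0
  map_coact : ∀ (r i n : ℕ) (h : n = r + i) (h' : (n : ℤ) = (r : ℤ) + (i : ℤ)) (x : M n),
    ρ' r i n h' (Φ n x) = LinearMap.lTensor (W r) (Φ i) (ρ r i n h x)
  map_coact_neg : ∀ (r n : ℕ) (i : ℤ) (h : (n : ℤ) = (r : ℤ) + i) (x : M n), i < 0 →
    ρ' r i n h (Φ n x) = 0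

/-- The differential of the normalized chains, with flexible indices. -/
def NC.d' (A : SMod.{u}) (i j : ℕ) (h : i = j + 1) : NC A i →ₗ[F2] NC A j := by
  subst h
  exact NC.d A j

/-- The composite of `φ_∞` with the normalization of the interchange map. -/
def Phi (V : CSMod.{u}) (n : ℕ) : NC (hOrb (tot V)) n →ₗ[F2] TCN (hOrbCos V) (n : ℤ) :=
  phi (hOrbCos V) n ∘ₗ NC.map (interchange V) n

end TotComod

end

noncomputable section

namespace TotComod

/-! ## The normalized chains and the Alexander-Whitney map -/

/-! All coactions involved are grouplike on generators. In each simplicial degree the module is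
spanned by elements `z` with coaction `b ⊗ z` for a single simplex `b` of `Bπ`, and on the class of
such a `z` the coaction of `W̄` is the front face of `b` tensor the back face of `z` (`coactN_mk`).
The coalgebra and comodule axioms then follow from the chain map property `aw_d` and from the ways
of cutting `[n]` into consecutive pieces (`coactN_coassoc`, `coactN_counit`). For the product total
complex they are checked one bidegree at a time. This suffices because each `W̄_r` is finite
dimensional, so that tensoring with it commutes with products (`lTensor_ext`, `lTensor_proj_rho3`).

Compatibility of `φ_∞ ∘ N(ζ)` with the coactions is a statement about shuffles. On a generator `z`
with label `β`, the component in cosimplicial degree `k` is a sum over shuffles `(a, b)`, and the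
term of `(a, b)` has label `b^* β`, because the interchange map evaluates the `Eπ` factor on `b`
alone (`isGrouplike_totEv_interchange`). The factor in `W̄_r` is the front face of `b^* β`. If one
of the first `r` steps goes in the direction of `Δ^k`, then `b` is constant on it and this factor is
degenerate (`mk_KB_of_eq_zero`). The surviving shuffles begin with `r` steps in the direction of the
other simplex, and what remains of them is an arbitrary shuffle belonging to the back face of `z`.
Their sum is the other side of the identity (`rhoCN_phiComp_of_add`); if `r` exceeds the degree of
`z`, none survive (`rhoCN_phiComp_of_lt`).

That `φ_∞` is a chain map is the Leibniz rule for the shuffle product modulo two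
(`sum_sum_δ_stepMap`, `flatSum_succ`). Faces at the corners of a lattice path cancel in pairs. The
other faces form the boundary in one of the two directions. In the cosimplicial direction they give
the cofaces, of which only `d^0` survives conormalization, and this cancels the horizontal
differential (`flatSum_eq_dh`). In the other direction they give the boundary in `Tot V`
(`flatSum_eq_phiComp_d`). -/

lemma add_add_add_of_char_two {M : Type*} [AddCommGroup M] [Module F2 M] (x y z : M) :
    x + z + (z + y) = x + y := by
  rw [add_assoc, ← add_assoc z, add_self_zero, zero_add]

/-- Signs are invisible over `F2`, so this is the boundary of the alternating face map complex,
which squares to zero. -/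
lemma bdry_bdry (A : SMod.{u}) (n : ℕ) (x : A _⦋n + 2⦌) :
    bdry A n (bdry A (n + 1) x) = 0 := by
  have hs : ∀ (M N : ModuleCat.{u} F2) (f : M ⟶ N) (i : ℕ), (-1 : ℤ) ^ i • f = f := by
    intro M N f i
    have hneg : -f = f := by
      rw [neg_eq_iff_add_eq_zero]
      ext y
      exact add_self_zero _
    rcases neg_one_pow_eq_or ℤ i with h | h <;> simp [h, hneg]
  have hb : ∀ m, bdry A m = (AlgebraicTopology.AlternatingFaceMapComplex.objD A m).hom := by
    intro m
    simp [bdry, AlgebraicTopology.AlternatingFaceMapComplex.objD, hs, ModuleCat.hom_sum]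
  rw [hb, hb]
  have := AlgebraicTopology.AlternatingFaceMapComplex.d_squared A n
  exact congrArg (fun f => f.hom x) this

lemma NC.d_d (A : SMod.{u}) (n : ℕ) (x : NC A (n + 2)) : NC.d A n (NC.d A (n + 1) x) = 0 := by
  obtain ⟨x, rfl⟩ := Submodule.mkQ_surjective _ x
  change NC.mk A n (bdry A n (bdry A (n + 1) x)) = 0
  rw [bdry_bdry, map_zero]

lemma bdry_apply (A : SMod.{u}) (n : ℕ) (x : A _⦋n + 1⦌) :
    bdry A n x = ∑ k : Fin (n + 2), act A (SimplexCategory.δ k) x := by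
  simp only [bdry, LinearMap.sum_apply]
  rfl

lemma NC.d_mk (A : SMod.{u}) (n : ℕ) (x : A _⦋n + 1⦌) :
    NC.d A n (NC.mk A (n + 1) x) = ∑ k : Fin (n + 2), NC.mk A n (act A (SimplexCategory.δ k) x) := by
  rw [← map_sum, ← bdry_apply]
  rfl

/-! ### Identities between front faces, back faces and cofaces -/

lemma hom_ext_val {m n : ℕ} {f g : ⦋m⦌ ⟶ ⦋n⦌}
    (h : ∀ i : Fin (m + 1), ((f.toOrderHom i : Fin (n + 1)) : ℕ) = (g.toOrderHom i : Fin (n + 1))) :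
    f = g := by
  ext i : 3
  exact Fin.ext (h i)

lemma front_val (p q n : ℕ) (h : n = p + q) (i : Fin (p + 1)) :
    (((front p q n h).toOrderHom i : Fin (n + 1)) : ℕ) = i := rfl

lemma back_val (p q n : ℕ) (h : n = p + q) (i : Fin (q + 1)) :
    (((back p q n h).toOrderHom i : Fin (n + 1)) : ℕ) = p + i := rfl

lemma comp_val {l m n : ℕ} (f : ⦋l⦌ ⟶ ⦋m⦌) (g : ⦋m⦌ ⟶ ⦋n⦌) (i : Fin (l + 1)) :
    (((f ≫ g).toOrderHom i : Fin (n + 1)) : ℕ) =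
      (g.toOrderHom (f.toOrderHom i : Fin (m + 1)) : Fin (n + 1)) := rfl

lemma δ_val {n : ℕ} (j : Fin (n + 2)) (i : Fin (n + 1)) :
    (((SimplexCategory.δ j).toOrderHom i : Fin (n + 2)) : ℕ) =
      if (i : ℕ) < j then (i : ℕ) else i + 1 := by
  change ((j.succAbove i : Fin (n + 2)) : ℕ) = _
  simp only [Fin.succAbove, Fin.lt_def, Fin.val_castSucc]
  split_ifs <;> rfl

lemma front_δ_of_le (p q n : ℕ) (h : n = p + q) (j : Fin (n + 2)) (i : Fin (p + 2))
    (hij : (i : ℕ) = j) :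
    front p q n h ≫ SimplexCategory.δ j =
      SimplexCategory.δ i ≫ front (p + 1) q (n + 1) (by omega) :=
  hom_ext_val fun l => by
    rw [comp_val, comp_val, δ_val, front_val, front_val, δ_val, hij]

lemma front_δ_of_lt (p q n : ℕ) (h : n = p + q) (j : Fin (n + 2)) (hj : p < j) :
    front p q n h ≫ SimplexCategory.δ j = front p (q + 1) (n + 1) (by omega) :=
  hom_ext_val fun l => by
    have := l.isLt
    rw [comp_val, δ_val, front_val, front_val, if_pos (by omega)]

lemma back_δ_of_le (p q n : ℕ) (h : n = p + q) (j : Fin (n + 2)) (hj : (j : ℕ) ≤ p) :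
    back p q n h ≫ SimplexCategory.δ j = back (p + 1) q (n + 1) (by omega) :=
  hom_ext_val fun l => by
    rw [comp_val, δ_val, back_val, back_val, if_neg (by omega)]
    omega

lemma back_δ_of_lt (p q n : ℕ) (h : n = p + q) (j : Fin (n + 2)) (i : Fin (q + 2))
    (hij : p + (i : ℕ) = j) :
    back p q n h ≫ SimplexCategory.δ j =
      SimplexCategory.δ i ≫ back p (q + 1) (n + 1) (by omega) :=
  hom_ext_val fun l => by
    rw [comp_val, comp_val, δ_val, back_val, back_val, δ_val]
    split_ifs <;> omega

/-- Together with `δ_zero_back` this shows that the last face of the front part and the zeroth face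
of the back part contribute the same tensor, so that these two terms cancel modulo two in `aw_d`. -/
lemma δ_last_front (p q n : ℕ) (h : n = p + q) :
    SimplexCategory.δ (Fin.last (p + 1)) ≫ front (p + 1) q (n + 1) (by omega) =
      front p (q + 1) (n + 1) (by omega) :=
  hom_ext_val fun l => by
    have := l.isLt
    rw [comp_val, front_val, δ_val, front_val, if_pos (by simpa using Nat.lt_succ_iff.1 this)]

lemma δ_zero_back (p q n : ℕ) (h : n = p + q) :
    SimplexCategory.δ (0 : Fin (q + 2)) ≫ back p (q + 1) (n + 1) (by omega) =
      back (p + 1) q (n + 1) (by omega) :=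
  hom_ext_val fun l => by
    rw [comp_val, back_val, δ_val, back_val, if_neg (by simp)]
    omega

/-- This lemma and the next two compare the two ways of cutting `[p + q + r]` into a front, a middle
and a back piece; coassociativity comes down to them. -/
lemma front_front (p q r m n : ℕ) (hm : m = p + q) (hn : n = m + r) :
    front p q m hm ≫ front m r n hn = front p (q + r) n (by omega) := rfl

lemma back_front (p q r m m' n : ℕ) (hm : m = p + q) (hn : n = m + r) (hm' : m' = q + r) :
    back p q m hm ≫ front m r n hn = front q r m' hm' ≫ back p m' n (by omega) := rfl

lemma back_back (p q r m n : ℕ) (hm : m = q + r) (hn : n = p + m) :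
    back q r m hm ≫ back p m n hn = back (p + q) r n (by omega) :=
  hom_ext_val fun l => by
    rw [comp_val, back_val, back_val, back_val]
    omega

lemma back_zero (n : ℕ) (h : n = 0 + n) : back 0 n n h = 𝟙 _ :=
  hom_ext_val fun l => by
    rw [back_val]
    exact zero_add _

lemma front_zero (n : ℕ) (h : n = n + 0) : front n 0 n h = 𝟙 _ := rfl

/-- The elementary tensors in a tensor product of simplicial modules. -/
def tens.tmul {A : SMod.{u}} {B : SMod.{v}} {X : SimplexCategoryᵒᵖ} (a : A.obj X) (b : B.obj X) :
    (tens A B).obj X := a ⊗ₜ[F2] b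

lemma tens.ext {A : SMod.{u}} {B : SMod.{v}} {M : Type*} [AddCommGroup M] [Module F2 M] {n : ℕ}
    {f g : NC (tens A B) n →ₗ[F2] M}
    (h : ∀ a b, f (NC.mk (tens A B) n (tens.tmul a b)) = g (NC.mk (tens A B) n (tens.tmul a b))) :
    f = g := by
  apply Submodule.linearMap_qext
  exact TensorProduct.ext' (M := A _⦋n⦌) (N := B _⦋n⦌) h

lemma tens.act_tmul {A : SMod.{u}} {B : SMod.{v}} {X Y : SimplexCategory} (θ : X ⟶ Y)
    (a : A.obj (op Y)) (b : B.obj (op Y)) :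
    act (tens A B) θ (tens.tmul a b) = tens.tmul (act A θ a) (act B θ b) := rfl

lemma aw_tmul {A : SMod.{u}} {B : SMod.{v}} (p q n : ℕ) (h : n = p + q) (a : A _⦋n⦌)
    (b : B _⦋n⦌) : aw A B p q n h (NC.mk (tens A B) n (tens.tmul a b)) =
      NC.mk A p (act A (front p q n h) a) ⊗ₜ[F2] NC.mk B q (act B (back p q n h) b) := rfl

/-- The Alexander-Whitney map is a chain map. -/
lemma aw_d (A : SMod.{u}) (B : SMod.{v}) (p q n : ℕ) (h : n = p + q)
    (x : NC (tens A B) (n + 1)) :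
    aw A B p q n h (NC.d (tens A B) n x) =
      LinearMap.rTensor (NC B q) (NC.d A p) (aw A B (p + 1) q (n + 1) (by omega) x) +
        LinearMap.lTensor (NC A p) (NC.d B q) (aw A B p (q + 1) (n + 1) (by omega) x) := by
  refine LinearMap.congr_fun (f := aw A B p q n h ∘ₗ NC.d (tens A B) n)
    (g := LinearMap.rTensor (NC B q) (NC.d A p) ∘ₗ aw A B (p + 1) q (n + 1) (by omega) +
        LinearMap.lTensor (NC A p) (NC.d B q) ∘ₗ aw A B p (q + 1) (n + 1) (by omega))
    (tens.ext fun a b => ?_) x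
  simp only [LinearMap.comp_apply, LinearMap.add_apply]
  rw [NC.d_mk, map_sum]
  simp only [tens.act_tmul, aw_tmul, act_act]
  rw [LinearMap.rTensor_tmul, LinearMap.lTensor_tmul, NC.d_mk, NC.d_mk,
    TensorProduct.sum_tmul, TensorProduct.tmul_sum,
    Fin.sum_univ_castSucc (n := p + 1), Fin.sum_univ_succ (n := q + 1)]
  simp only [act_act]
  rw [δ_last_front p q n h, δ_zero_back p q n h]
  -- The faces `d_j` with `j ≤ p` change only the front factor, those with `j > p` only the back
  -- factor.
  have hc : (p + 1) + (q + 1) = n + 2 := by omega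
  rw [← Fin.sum_congr' _ hc, Fin.sum_univ_add]
  have h1 : ∀ i : Fin (p + 1), front p q n h ≫
      SimplexCategory.δ ((Fin.castAdd (q + 1) i).cast hc) =
      SimplexCategory.δ i.castSucc ≫ front (p + 1) q (n + 1) (by omega) := fun i =>
    front_δ_of_le p q n h _ _ rfl
  have h2 : ∀ i : Fin (p + 1), back p q n h ≫
      SimplexCategory.δ ((Fin.castAdd (q + 1) i).cast hc) =
      back (p + 1) q (n + 1) (by omega) := fun i =>
    back_δ_of_le p q n h _ (by have := i.isLt; simp; omega)
  have h3 : ∀ i : Fin (q + 1), front p q n h ≫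
      SimplexCategory.δ ((Fin.natAdd (p + 1) i).cast hc) =
      front p (q + 1) (n + 1) (by omega) := fun i =>
    front_δ_of_lt p q n h _ (by simp; omega)
  have h4 : ∀ i : Fin (q + 1), back p q n h ≫
      SimplexCategory.δ ((Fin.natAdd (p + 1) i).cast hc) =
      SimplexCategory.δ i.succ ≫ back p (q + 1) (n + 1) (by omega) := fun i =>
    back_δ_of_lt p q n h _ _ (by simp; omega)
  simp only [h1, h2, h3, h4]
  exact (add_add_add_of_char_two _ _ _).symm

/-! ## Coactions that are grouplike on generators -/

section Coaction

variable {B : SMod.{u}} (ψ : B ⟶ tens KB B)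

/-- The components of the coaction on normalized chains induced by a coaction of `F2[Bπ]`. -/
def coactN (r s n : ℕ) (h : n = r + s) : NC B n →ₗ[F2] Wbar r ⊗[F2] NC B s :=
  aw KB B r s n h ∘ₗ NC.map ψ n

/-- The coaction sends `z` to `b ⊗ z`. -/
def IsGrouplike {X : SimplexCategory} (z : B.obj (op X)) (b : BObj X) : Prop :=
  (ψ.app (op X)).hom z = (show KB.obj (op X) from Lin.of b) ⊗ₜ[F2] z

/-- Every module `B_n` is spanned by elements `z` with coaction `b ⊗ z` for some `b`. -/
def IsGrouplikeSpanned : Prop :=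
  ∀ X : SimplexCategory, Submodule.span F2 (Set.ofPred fun z : B.obj (op X) => ∃ b, IsGrouplike ψ z b) = ⊤

/-- A basis element of `F2[Bπ]`. -/
def KB.of {X : SimplexCategory} (b : BObj X) : KB.obj (op X) := Lin.of b

lemma act_KB_of {X Y : SimplexCategory} (θ : X ⟶ Y) (b : BObj Y) :
    act KB θ (KB.of b) = KB.of (BMap θ b) := Lin.map_of _ _

variable {ψ}

lemma IsGrouplike.act {X Y : SimplexCategory} (θ : X ⟶ Y) {z : B.obj (op Y)} {b : BObj Y}
    (h : IsGrouplike ψ z b) : IsGrouplike ψ (act B θ z) (BMap θ b) := by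
  unfold IsGrouplike at *
  rw [app_act, h]
  exact congrArg (· ⊗ₜ[F2] TotComod.act B θ z) (act_KB_of θ b)

/-- On a generator the coaction is a single elementary tensor, which makes the axioms verifiable by
composing order maps. -/
lemma coactN_mk {r s n : ℕ} (h : n = r + s) {z : B _⦋n⦌} {b : BObj ⦋n⦌}
    (hz : IsGrouplike ψ z b) :
    coactN ψ r s n h (NC.mk B n z) =
      NC.mk KB r (KB.of (BMap (front r s n h) b)) ⊗ₜ[F2] NC.mk B s (act B (back r s n h) z) := by
  rw [← act_KB_of]
  exact congrArg (awPre KB B r s n h) hz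

/-- Holds for every simplicial map `ψ`, as a composite of two chain maps. -/
lemma coactN_d (r s n : ℕ) (h : n = r + s) (x : NC B (n + 1)) :
    coactN ψ r s n h (NC.d B n x) =
      LinearMap.rTensor (NC B s) (Wbar.d r) (coactN ψ (r + 1) s (n + 1) (by omega) x) +
        LinearMap.lTensor (Wbar r) (NC.d B s) (coactN ψ r (s + 1) (n + 1) (by omega) x) := by
  simp only [coactN, LinearMap.comp_apply]
  rw [← NC.d_map, aw_d]
  rfl

/-- Linear maps on the normalized chains agree if they agree on grouplike generators. -/
lemma IsGrouplikeSpanned.ext (hB : IsGrouplikeSpanned ψ) {M : Type*} [AddCommGroup M]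
    [Module F2 M] {n : ℕ} {f g : NC B n →ₗ[F2] M}
    (h : ∀ (z : B _⦋n⦌) (b : BObj ⦋n⦌), IsGrouplike ψ z b → f (NC.mk B n z) = g (NC.mk B n z)) :
    f = g := by
  apply Submodule.linearMap_qext
  refine LinearMap.ext_on (hB ⦋n⦌) ?_
  rintro z ⟨b, hz⟩
  exact h z b hz

lemma BMap_BMap {X Y Z : SimplexCategory} (θ : X ⟶ Y) (η : Y ⟶ Z) (b : BObj Z) :
    BMap θ (BMap η b) = BMap (θ ≫ η) b := by
  induction b using Quotient.inductionOn with
  | h e => rfl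

lemma BMap_id {X : SimplexCategory} (b : BObj X) : BMap (𝟙 X) b = b := by
  induction b using Quotient.inductionOn with
  | h e => rfl

lemma isGrouplike_psiB {X : SimplexCategory} (b : BObj X) : IsGrouplike psiB (KB.of b) b :=
  diag_of b

lemma isGrouplikeSpanned_psiB : IsGrouplikeSpanned psiB := by
  intro X
  rw [eq_top_iff]
  refine le_trans (b := Submodule.span F2 (Set.range (Lin.of (S := BObj X)))) ?_ ?_
  · have : (⊤ : Submodule F2 (BObj X →₀ F2)) ≤
      Submodule.span F2 (Set.range fun b => Finsupp.single b (1 : F2)) :=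
      (Finsupp.basisSingleOne (R := F2) (ι := BObj X)).span_eq.symm.le.trans
        (by simp [Finsupp.coe_basisSingleOne])
    exact this
  · apply Submodule.span_mono
    rintro _ ⟨b, rfl⟩
    exact ⟨b, isGrouplike_psiB b⟩

lemma comul_mk {p q n : ℕ} (h : n = p + q) (b : BObj ⦋n⦌) :
    Wbar.comul p q n h (NC.mk KB n (KB.of b)) =
      NC.mk KB p (KB.of (BMap (front p q n h) b)) ⊗ₜ[F2]
        NC.mk KB q (KB.of (BMap (back p q n h) b)) := by
  rw [← act_KB_of (back p q n h)]
  exact coactN_mk h (isGrouplike_psiB b)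

lemma counit_mk (b : BObj ⦋0⦌) : Wbar.counit (NC.mk KB 0 (KB.of b)) = 1 :=
  Lin.lift_of _ b

/-- On a generator both sides are the tensor of the front and middle faces of `b` with the back face
of `z`. -/
lemma coactN_coassoc (hB : IsGrouplikeSpanned ψ) (p q r m n : ℕ) (hm : m = q + r)
    (hpq : n = p + q + r) (hn : n = p + m) (x : NC B n) :
    TensorProduct.assoc F2 (Wbar p) (Wbar q) (NC B r)
        (LinearMap.rTensor (NC B r) (Wbar.comul p q (p + q) rfl) (coactN ψ (p + q) r n hpq x)) =
      LinearMap.lTensor (Wbar p) (coactN ψ q r m hm) (coactN ψ p m n hn x) := by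
  refine LinearMap.congr_fun (f := (TensorProduct.assoc F2 (Wbar p) (Wbar q) (NC B r)).toLinearMap ∘ₗ
    LinearMap.rTensor (NC B r) (Wbar.comul p q (p + q) rfl) ∘ₗ coactN ψ (p + q) r n hpq)
    (g := LinearMap.lTensor (Wbar p) (coactN ψ q r m hm) ∘ₗ coactN ψ p m n hn)
    (hB.ext fun z b hz => ?_) x
  simp only [LinearMap.comp_apply, LinearEquiv.coe_coe]
  rw [coactN_mk hpq hz, LinearMap.rTensor_tmul, comul_mk, TensorProduct.assoc_tmul,
    coactN_mk hn hz, LinearMap.lTensor_tmul, coactN_mk hm (hz.act _)]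
  simp only [BMap_BMap, act_act]
  subst hm
  rw [front_front, back_front (m' := q + r) (hm' := rfl), back_back]

/-- The front vertex of `b` has augmentation one, and the complementary back face is everything. -/
lemma coactN_counit (hB : IsGrouplikeSpanned ψ) (n : ℕ) (h : n = 0 + n) (x : NC B n) :
    TensorProduct.lid F2 (NC B n)
      (LinearMap.rTensor (NC B n) Wbar.counit (coactN ψ 0 n n h x)) = x := by
  refine LinearMap.congr_fun (f := (TensorProduct.lid F2 (NC B n)).toLinearMap ∘ₗ
    LinearMap.rTensor (NC B n) Wbar.counit ∘ₗ coactN ψ 0 n n h) (g := LinearMap.id)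
    (hB.ext fun z b hz => ?_) x
  simp only [LinearMap.comp_apply, LinearEquiv.coe_coe]
  rw [coactN_mk h hz, LinearMap.rTensor_tmul, counit_mk, TensorProduct.lid_tmul, one_smul,
    back_zero, act_id]
  rfl

end Coaction

/-- `W̄` is a differential graded coalgebra. -/
lemma isDGCoalgebra_Wbar : IsDGCoalgebra Wbar Wbar.d Wbar.comul Wbar.counit where
  d_comp_d n x := NC.d_d KB n x
  counit_d x := by
    refine LinearMap.congr_fun (f := Wbar.counit ∘ₗ Wbar.d 0) (g := 0)
      (isGrouplikeSpanned_psiB.ext fun z b hz => ?_) x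
    -- Both vertices of an edge have augmentation one, and `1 + 1 = 0`.
    have hz' : Wbar.counit ∘ₗ Wbar.d 0 ∘ₗ NC.mk KB 1 = 0 := by
      refine Lin.ext fun b => ?_
      change Wbar.counit (NC.d KB 0 (NC.mk KB 1 (KB.of b))) = 0
      rw [NC.d_mk, Fin.sum_univ_two, act_KB_of, act_KB_of, map_add, counit_mk, counit_mk]
      exact add_self_zero _
    exact LinearMap.congr_fun hz' z
  comul_d p q n h x := coactN_d p q n h x
  coassoc p q r n h x := coactN_coassoc isGrouplikeSpanned_psiB p q r (q + r) n rfl h _ x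
  counit_left n x := coactN_counit isGrouplikeSpanned_psiB n _ x
  counit_right n x := by
    -- The right counit has no analogue for left comodules, so it is checked directly on simplices
    -- of `Bπ`.
    refine LinearMap.congr_fun (f := (TensorProduct.rid F2 (Wbar n)).toLinearMap ∘ₗ
      LinearMap.lTensor (Wbar n) Wbar.counit ∘ₗ Wbar.comul n 0 n (by omega)) (g := LinearMap.id)
      ?_ x
    apply Submodule.linearMap_qext
    refine Lin.ext fun b => ?_
    change TensorProduct.rid F2 (Wbar n) (LinearMap.lTensor (Wbar n) Wbar.counit
      (Wbar.comul n 0 n (by omega) (NC.mk KB n (KB.of b)))) = NC.mk KB n (KB.of b)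
    rw [comul_mk, LinearMap.lTensor_tmul, counit_mk, TensorProduct.rid_tmul, one_smul,
      front_zero, BMap_id]

/-! ## The coaction on homotopy orbits -/

lemma isGrouplike_orbMk (A : SMod.{u}) {X : SimplexCategory} (e : EObj X) (x y : A.obj (op X)) :
    IsGrouplike (rho1 A) (show (hOrb A).obj (op X) from orbMk X e x y) (EB X e) :=
  orbCoact_mk X e x y

/-- The quotient map by the span vanishes on all classes `e ⊗ x ⊗ y`, hence is zero. -/
lemma isGrouplikeSpanned_rho1 (A : SMod.{u}) : IsGrouplikeSpanned (rho1 A) := by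
  intro X
  set P := Submodule.span F2
    (Set.ofPred fun z : (hOrb A).obj (op X) => ∃ b, IsGrouplike (rho1 A) z b) with hP
  have h : P.mkQ = 0 := by
    refine orb_ext X (M := A.obj (op X)) fun e x y => ?_
    refine (Submodule.Quotient.mk_eq_zero _).2 ?_
    exact Submodule.subset_span ⟨_, isGrouplike_orbMk A e x y⟩
  rw [← Submodule.ker_mkQ P, h, LinearMap.ker_zero]

/-- By definition `rho2 A` is `coactN (rho1 A)`, so the general statements about grouplike coactions
apply. -/
lemma isDGComodule_rho2 (A : SMod.{u}) :
    IsDGComodule Wbar Wbar.d Wbar.comul Wbar.counit (NC (hOrb A)) (NC.d' (hOrb A)) (rho2 A) where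
  d_comp_d i j k hi hj x := by
    subst hj hi
    exact NC.d_d _ _ x
  coact_d r i i' n n' hi hn h h₁ h₂ x := by
    subst hi hn
    exact coactN_d r i n h x
  coassoc p q i j n h hj hn x :=
    coactN_coassoc (isGrouplikeSpanned_rho1 A) p q i j n hj h hn x
  counit i h x := coactN_counit (isGrouplikeSpanned_rho1 A) i _ x

/-! ## The coaction on the product total complex -/

section Tensor

variable {W W₁ W₂ : Type v} [AddCommGroup W] [Module F2 W] [AddCommGroup W₁] [Module F2 W₁]
  [AddCommGroup W₂] [Module F2 W₂] {M N : Type u} [AddCommGroup M] [Module F2 M]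
  [AddCommGroup N] [Module F2 N]

lemma lTensor_rTensor (f : W →ₗ[F2] W₁) (g : M →ₗ[F2] N) (t : W ⊗[F2] M) :
    LinearMap.lTensor W₁ g (LinearMap.rTensor M f t) =
      LinearMap.rTensor N f (LinearMap.lTensor W g t) := by
  rw [← LinearMap.comp_apply, ← LinearMap.comp_apply, LinearMap.lTensor_comp_rTensor,
    LinearMap.rTensor_comp_lTensor]

/-- Naturality of coassociativity in the comodule variable. It is applied with `g` the quotient map
to the conormalization and with `g` the projection to a bidegree; `lid_rTensor_lTensor` plays the
same role for the counit. -/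
lemma lTensor_lTensor_assoc (f : W →ₗ[F2] W₁ ⊗[F2] W₂) (g : M →ₗ[F2] N) (t : W ⊗[F2] M) :
    LinearMap.lTensor W₁ (LinearMap.lTensor W₂ g)
        (TensorProduct.assoc F2 W₁ W₂ M (LinearMap.rTensor M f t)) =
      TensorProduct.assoc F2 W₁ W₂ N (LinearMap.rTensor N f (LinearMap.lTensor W g t)) := by
  rw [← lTensor_rTensor]
  generalize LinearMap.rTensor M f t = c
  induction c with
  | zero => simp
  | add x y hx hy => simp only [map_add, hx, hy]
  | tmul c d =>
    induction c with
    | zero => simp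
    | add x y hx hy => simp only [map_add, add_tmul, hx, hy]
    | tmul c c' => simp

lemma lid_rTensor_lTensor (f : W →ₗ[F2] F2) (g : M →ₗ[F2] N) (t : W ⊗[F2] M) :
    TensorProduct.lid F2 N (LinearMap.rTensor N f (LinearMap.lTensor W g t)) =
      g (TensorProduct.lid F2 M (LinearMap.rTensor M f t)) := by
  induction t with
  | zero => simp
  | add x y hx hy => simp only [map_add, hx, hy]
  | tmul a b => simp

end Tensor

/-- For a finite dimensional `W`, a jointly injective family of linear maps stays jointly injective
after tensoring with `W`. -/
lemma lTensor_ext {W : Type v} [AddCommGroup W] [Module F2 W] [Module.Finite F2 W] {ι : Type w}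
    {M : Type u} [AddCommGroup M] [Module F2 M]
    {N : ι → Type u} [∀ i, AddCommGroup (N i)] [∀ i, Module F2 (N i)] (f : ∀ i, M →ₗ[F2] N i)
    (hf : ∀ x, (∀ i, f i x = 0) → x = 0) {y z : W ⊗[F2] M}
    (h : ∀ i, LinearMap.lTensor W (f i) y = LinearMap.lTensor W (f i) z) : y = z := by
  -- Flatness preserves the injection of `M` into the product; finite dimension of `W` then allows
  -- comparison in each factor by `tensorPi`.
  have hinj : Function.Injective (LinearMap.lTensor W (LinearMap.pi f)) := by
    apply Module.Flat.lTensor_preserves_injective_linearMap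
    rw [injective_iff_map_eq_zero]
    intro x hx
    exact hf x fun i => congrFun hx i
  apply hinj
  apply (tensorPi W N).injective
  funext i
  have key : ∀ t, tensorPi W N (LinearMap.lTensor W (LinearMap.pi f) t) i =
      LinearMap.lTensor W (f i) t := by
    intro t
    change LinearMap.lTensor W (LinearMap.proj i) (LinearMap.lTensor W (LinearMap.pi f) t) = _
    rw [← LinearMap.lTensor_comp_apply]
    rfl
  rw [key, key, h]

/-! ### The differentials of the double complex and of its total complex -/

lemma CN.dv_dv (V : CSMod.{u}) (k s : ℕ) (x : CN V k (s + 2)) :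
    CN.dv V k s (CN.dv V k (s + 1) x) = 0 := by
  obtain ⟨x, rfl⟩ := Submodule.mkQ_surjective _ x
  change (coface V k s).mkQ (NC.d _ s (NC.d _ (s + 1) x)) = 0
  rw [NC.d_d, map_zero]

lemma mkQ_coface_map (V : CSMod.{u}) (k s : ℕ) (j : Fin (k + 1)) (x : NC (V.obj ⦋k⦌) s) :
    (coface V (k + 1) s).mkQ (NC.map (V.map (SimplexCategory.δ j.succ)) s x) = 0 := by
  refine (Submodule.Quotient.mk_eq_zero _).2 ?_
  change _ ∈ ⨆ j : Fin (k + 1), LinearMap.range (NC.map (V.map (SimplexCategory.δ j.succ)) s)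
  exact Submodule.mem_iSup_of_mem j ⟨x, rfl⟩

/-- The cosimplicial identity `d^0 d^0 = d^1 d^0` puts the image in a submodule killed by
conormalization. -/
lemma CN.dh_dh (V : CSMod.{u}) (k s : ℕ) (x : CN V k s) :
    CN.dh V (k + 1) s (CN.dh V k s x) = 0 := by
  obtain ⟨x, rfl⟩ := Submodule.mkQ_surjective _ x
  change (coface V (k + 2) s).mkQ (NC.map (V.map (SimplexCategory.δ 0)) s
    (NC.map (V.map (SimplexCategory.δ 0)) s x)) = 0
  have hδ : SimplexCategory.δ (0 : Fin (k + 2)) ≫ SimplexCategory.δ 0 =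
      SimplexCategory.δ 0 ≫ SimplexCategory.δ (0 : Fin (k + 2)).succ :=
    (SimplexCategory.δ_comp_δ (le_refl (0 : Fin (k + 2)))).symm
  rw [← NC.map_comp, ← V.map_comp, hδ, V.map_comp, NC.map_comp]
  exact mkQ_coface_map V (k + 1) s 0 _

lemma CN.dv_dh (V : CSMod.{u}) (k s : ℕ) (x : CN V k (s + 1)) :
    CN.dv V (k + 1) s (CN.dh V k (s + 1) x) = CN.dh V k s (CN.dv V k s x) := by
  obtain ⟨x, rfl⟩ := Submodule.mkQ_surjective _ x
  exact congrArg (coface V (k + 1) s).mkQ (NC.d_map (V.map (SimplexCategory.δ 0)) s x)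

lemma TCN.d_zero_apply (V : CSMod.{u}) (i j : ℤ) (h : i = j + 1) (x : TCN V i) (s : ℕ)
    (hs : (s : ℤ) = j + (0 : ℕ)) :
    TCN.d V i j h x ⟨(0, s), hs⟩ =
      CN.dv V 0 s (x ⟨(0, s + 1), by push_cast at hs ⊢; omega⟩) := rfl

lemma TCN.d_succ_apply (V : CSMod.{u}) (i j : ℤ) (h : i = j + 1) (x : TCN V i) (k s : ℕ)
    (hs : (s : ℤ) = j + (k + 1 : ℕ)) :
    TCN.d V i j h x ⟨(k + 1, s), hs⟩ =
      CN.dv V (k + 1) s (x ⟨(k + 1, s + 1), by push_cast at hs ⊢; omega⟩) +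
        CN.dh V k s (x ⟨(k, s), by push_cast at hs ⊢; omega⟩) := rfl

/-- The two mixed terms agree by `CN.dv_dh` and cancel modulo two. The cases are the columns reached
by no, by one and by two horizontal differentials. -/
lemma TCN.d_d (V : CSMod.{u}) (i j l : ℤ) (hi : i = j + 1) (hj : j = l + 1) (x : TCN V i) :
    TCN.d V j l hj (TCN.d V i j hi x) = 0 := by
  funext ks
  obtain ⟨⟨k, s⟩, hs⟩ := ks
  rcases k with _ | _ | k
  · rw [TCN.d_zero_apply, TCN.d_zero_apply, CN.dv_dv]
    rfl
  · rw [TCN.d_succ_apply, TCN.d_succ_apply, TCN.d_zero_apply, map_add, CN.dv_dv, CN.dv_dh]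
    exact (congrArg (· + _) (zero_add _)).trans (add_self_zero _)
  · rw [TCN.d_succ_apply, TCN.d_succ_apply, TCN.d_succ_apply, map_add, map_add, CN.dv_dv,
      CN.dv_dh, CN.dh_dh, zero_add, add_zero, add_self_zero]
    rfl

/-! ### The coaction in a fixed bidegree -/

section RhoCN

variable (V : CSMod.{u}) (k r s n : ℕ) (h : n = r + s)

/-- The coaction of `F2[Bπ]` in cosimplicial degree `k`. -/
def rhoCos : (hOrbCos V).obj ⦋k⦌ ⟶ tens KB ((hOrbCos V).obj ⦋k⦌) := rho1 (V.obj ⦋k⦌)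

lemma isGrouplikeSpanned_rhoCos : IsGrouplikeSpanned (rhoCos V k) :=
  isGrouplikeSpanned_rho1 (V.obj ⦋k⦌)

lemma coactN_rhoCos_map (j : Fin (k + 2)) (x : NC ((hOrbCos V).obj ⦋k⦌) n) :
    coactN (rhoCos V (k + 1)) r s n h
        (NC.map ((hOrbCos V).map (SimplexCategory.δ j)) n x) =
      LinearMap.lTensor (Wbar r) (NC.map ((hOrbCos V).map (SimplexCategory.δ j)) s)
        (coactN (rhoCos V k) r s n h x) :=
  rho2_natural (V.map (SimplexCategory.δ j)) r s n h x

lemma rhoCN_mkQ (y : NC ((hOrbCos V).obj ⦋k⦌) n) :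
    rhoCN V k r s n h ((coface (hOrbCos V) k n).mkQ y) =
      LinearMap.lTensor (Wbar r) (coface (hOrbCos V) k s).mkQ (coactN (rhoCos V k) r s n h y) :=
  rfl

lemma rhoCN_dv (x : CN (hOrbCos V) k (n + 1)) :
    rhoCN V k r s n h (CN.dv (hOrbCos V) k n x) =
      LinearMap.rTensor _ (Wbar.d r) (rhoCN V k (r + 1) s (n + 1) (by omega) x) +
        LinearMap.lTensor (Wbar r) (CN.dv (hOrbCos V) k s)
          (rhoCN V k r (s + 1) (n + 1) (by omega) x) := by
  obtain ⟨x, rfl⟩ := Submodule.mkQ_surjective _ x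
  change LinearMap.lTensor (Wbar r) (coface (hOrbCos V) k s).mkQ
    (coactN (rhoCos V k) r s n h (NC.d _ n x)) = _
  rw [coactN_d, map_add, rhoCN_mkQ, rhoCN_mkQ, lTensor_rTensor, ← LinearMap.lTensor_comp_apply,
    ← LinearMap.lTensor_comp_apply]
  rfl

/-- The cofaces leave the factor `Eπ` untouched, so they act only on the right factor of the
coaction. -/
lemma rhoCN_dh (x : CN (hOrbCos V) k n) :
    rhoCN V (k + 1) r s n h (CN.dh (hOrbCos V) k n x) =
      LinearMap.lTensor (Wbar r) (CN.dh (hOrbCos V) k s) (rhoCN V k r s n h x) := by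
  obtain ⟨x, rfl⟩ := Submodule.mkQ_surjective _ x
  change LinearMap.lTensor (Wbar r) (coface (hOrbCos V) (k + 1) s).mkQ
    (coactN (rhoCos V (k + 1)) r s n h
      (NC.map ((hOrbCos V).map (SimplexCategory.δ 0)) n x)) = _
  rw [coactN_rhoCos_map, rhoCN_mkQ, ← LinearMap.lTensor_comp_apply,
    ← LinearMap.lTensor_comp_apply]
  rfl

lemma rhoCN_counit (n : ℕ) (h : n = 0 + n) (x : CN (hOrbCos V) k n) :
    TensorProduct.lid F2 _ (LinearMap.rTensor _ Wbar.counit (rhoCN V k 0 n n h x)) = x := by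
  obtain ⟨x, rfl⟩ := Submodule.mkQ_surjective _ x
  rw [rhoCN_mkQ, lid_rTensor_lTensor, coactN_counit (isGrouplikeSpanned_rhoCos V k)]

lemma rhoCN_coassoc (p q i j n : ℕ) (h : n = p + q + i) (hj : j = q + i)
    (hn : n = p + j) (x : CN (hOrbCos V) k n) :
    TensorProduct.assoc F2 (Wbar p) (Wbar q) _
        (LinearMap.rTensor _ (Wbar.comul p q (p + q) rfl) (rhoCN V k (p + q) i n h x)) =
      LinearMap.lTensor (Wbar p) (rhoCN V k q i j hj) (rhoCN V k p j n hn x) := by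
  obtain ⟨x, rfl⟩ := Submodule.mkQ_surjective _ x
  rw [rhoCN_mkQ, rhoCN_mkQ, ← lTensor_lTensor_assoc,
    coactN_coassoc (isGrouplikeSpanned_rhoCos V k) p q i j n hj h hn,
    ← LinearMap.lTensor_comp_apply, ← LinearMap.lTensor_comp_apply]
  rfl

end RhoCN

/-! ### From single bidegrees to the product total complex -/

/-- Projecting to a bidegree undoes the inverse of `tensorPi` in the definition of `rho3`, which
turns identities for `rho3` into identities for `rhoCN`. The free index `m` avoids casts between
equal degrees. -/
lemma lTensor_proj_rho3 (V : CSMod.{u}) (r : ℕ) (i n : ℤ) (h : n = (r : ℤ) + i) (x : TCN (hOrbCos V) n)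
    (k s m : ℕ) (hs : (s : ℤ) = i + k) (hm : m = r + s) (hm' : (m : ℤ) = n + k) :
    LinearMap.lTensor (Wbar r) (LinearMap.proj (⟨(k, s), hs⟩ : TIdx i)) (rho3 V r i n h x) =
      rhoCN V k r s m hm (x ⟨(k, m), hm'⟩) := by
  subst hm
  change tensorPi (Wbar r) (fun ks : TIdx i => CN (hOrbCos V) ks.1.1 ks.1.2)
    ((tensorPi (Wbar r) fun ks : TIdx i => CN (hOrbCos V) ks.1.1 ks.1.2).symm _) _ = _
  rw [LinearEquiv.apply_symm_apply]
  rfl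

lemma lTensor_TCN_ext {V : CSMod.{u}} {W : Type v} [AddCommGroup W] [Module F2 W]
    [Module.Finite F2 W] {i : ℤ} {y z : W ⊗[F2] TCN V i}
    (h : ∀ (k s : ℕ) (hs : (s : ℤ) = i + k),
      LinearMap.lTensor W (LinearMap.proj (⟨(k, s), hs⟩ : TIdx i)) y =
        LinearMap.lTensor W (LinearMap.proj (⟨(k, s), hs⟩ : TIdx i)) z) : y = z :=
  lTensor_ext (N := fun ks : TIdx i => CN V ks.1.1 ks.1.2) (fun ks => LinearMap.proj ks)
    (fun _ hx => funext hx) fun ⟨⟨k, s⟩, hs⟩ => h k s hs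

/-- Needed for coassociativity, whose values have two factors from `W̄`; the inner factor is
absorbed into the jointly injective family. -/
lemma lTensor_lTensor_TCN_ext {V : CSMod.{u}} {W : Type v} [AddCommGroup W] [Module F2 W]
    [Module.Finite F2 W] {W' : Type} [AddCommGroup W'] [Module F2 W']
    [Module.Finite F2 W'] {i : ℤ} {y z : W ⊗[F2] (W' ⊗[F2] TCN V i)}
    (h : ∀ (k s : ℕ) (hs : (s : ℤ) = i + k),
      LinearMap.lTensor W (LinearMap.lTensor W' (LinearMap.proj (⟨(k, s), hs⟩ : TIdx i))) y =
        LinearMap.lTensor W (LinearMap.lTensor W' (LinearMap.proj (⟨(k, s), hs⟩ : TIdx i))) z) :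
    y = z :=
  lTensor_ext (N := fun ks : TIdx i => W' ⊗[F2] CN V ks.1.1 ks.1.2)
    (fun ks => LinearMap.lTensor W' (LinearMap.proj ks))
    (fun x hx => lTensor_TCN_ext fun k s hs => by rw [map_zero]; exact hx ⟨(k, s), hs⟩)
    fun ⟨⟨k, s⟩, hs⟩ => h k s hs

lemma isDGComodule_rho3 (V : CSMod.{u}) :
    IsDGComodule Wbar Wbar.d Wbar.comul Wbar.counit (TCN (hOrbCos V)) (TCN.d (hOrbCos V))
      (rho3 V) where
  d_comp_d i j l hi hj x := TCN.d_d _ i j l hi hj x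
  coact_d r i i' n n' hi hn h h₁ h₂ x := by
    refine lTensor_TCN_ext fun k s hs => ?_
    rw [map_add, lTensor_rTensor, lTensor_proj_rho3 V r i n h _ k s (r + s) hs rfl (by push_cast; omega),
      lTensor_proj_rho3 V (r + 1) i n' h₁ _ k s (r + s + 1) hs (by omega) (by push_cast; omega),
      ← LinearMap.lTensor_comp_apply]
    -- No horizontal differential arrives in the column `k = 0`.
    cases k with
    | zero =>
      have hd : LinearMap.proj (⟨(0, s), hs⟩ : TIdx i) ∘ₗ TCN.d (hOrbCos V) i' i hi =
        CN.dv (hOrbCos V) 0 s ∘ₗ LinearMap.proj (⟨(0, s + 1), by omega⟩ : TIdx i') := rfl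
      rw [hd, LinearMap.lTensor_comp_apply, TCN.d_zero_apply, rhoCN_dv,
        lTensor_proj_rho3 V r i' n' h₂ _ 0 (s + 1) (r + s + 1) (by omega) (by omega)
          (by push_cast; omega)]
    | succ k =>
      have hd : LinearMap.proj (⟨(k + 1, s), hs⟩ : TIdx i) ∘ₗ TCN.d (hOrbCos V) i' i hi =
        CN.dv (hOrbCos V) (k + 1) s ∘ₗ
            LinearMap.proj (⟨(k + 1, s + 1), by omega⟩ : TIdx i') +
          CN.dh (hOrbCos V) k s ∘ₗ
            LinearMap.proj (⟨(k, s), by push_cast at hs; omega⟩ : TIdx i') := rfl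
      rw [hd, LinearMap.lTensor_add, LinearMap.add_apply, LinearMap.lTensor_comp_apply,
        LinearMap.lTensor_comp_apply, TCN.d_succ_apply, map_add, rhoCN_dv, rhoCN_dh,
        lTensor_proj_rho3 V r i' n' h₂ _ (k + 1) (s + 1) (r + s + 1) (by omega) (by omega)
          (by push_cast at hs ⊢; omega),
        lTensor_proj_rho3 V r i' n' h₂ _ k s (r + s) (by push_cast at hs; omega) rfl
          (by push_cast at hs ⊢; omega), add_assoc]
  coassoc p q i j n h hj hn x := by
    refine lTensor_lTensor_TCN_ext fun k s hs => ?_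
    have hR : LinearMap.lTensor (Wbar p) (LinearMap.lTensor (Wbar q)
        (LinearMap.proj (⟨(k, s), hs⟩ : TIdx i)))
        (LinearMap.lTensor (Wbar p) (rho3 V q i j hj) (rho3 V p j n hn x)) =
        LinearMap.lTensor (Wbar p) (rhoCN V k q s (q + s) rfl)
          (rhoCN V k p (q + s) (p + q + s) (by omega)
            (x ⟨(k, p + q + s), by push_cast at h ⊢; omega⟩)) := by
      rw [← lTensor_proj_rho3 V p j n hn x k (q + s) (p + q + s) (by push_cast; omega)
        (by omega) (by push_cast at h ⊢; omega), ← LinearMap.lTensor_comp_apply,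
        ← LinearMap.lTensor_comp_apply]
      congr 2
      refine LinearMap.ext fun y => ?_
      exact lTensor_proj_rho3 V q i j hj y k s (q + s) hs rfl (by push_cast; omega)
    rw [lTensor_lTensor_assoc, hR, lTensor_proj_rho3 V (p + q) i n h x k s (p + q + s) hs rfl
      (by push_cast at h ⊢; omega), rhoCN_coassoc]
  counit i h x := by
    funext ks
    obtain ⟨⟨k, s⟩, hs⟩ := ks
    change (LinearMap.proj (⟨(k, s), hs⟩ : TIdx i) : TCN (hOrbCos V) i →ₗ[F2] _) (TensorProduct.lid F2 _
      (LinearMap.rTensor _ Wbar.counit (rho3 V 0 i i h x))) = _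
    rw [← lid_rTensor_lTensor, lTensor_proj_rho3 V 0 i i h x k s s hs (by omega) hs, rhoCN_counit]

/-! ## Shuffles -/

/-- The number of elements of `S` below `i`. -/
def countBelow {n : ℕ} (S : Finset (Fin n)) (i : ℕ) : ℕ := (S.filter fun j : Fin n => (j : ℕ) < i).card

lemma stepMap_val {k n : ℕ} (S : Finset (Fin n)) (hS : S.card = k) (i : Fin (n + 1)) :
    (((stepMap S hS).toOrderHom i : Fin (k + 1)) : ℕ) = countBelow S i := rfl

lemma countBelow_compl {n : ℕ} (S : Finset (Fin n)) (i : ℕ) (hi : i ≤ n) :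
    countBelow Sᶜ i + countBelow S i = i := by
  have h := Finset.card_filter_add_card_filter_not
    (s := Finset.univ.filter fun j : Fin n => (j : ℕ) < i) (fun j => j ∈ S)
  have hc : (Finset.univ.filter fun j : Fin n => (j : ℕ) < i).card = i := by
    simp [Fin.card_filter_val_lt, hi]
  rw [hc, Finset.filter_filter, Finset.filter_filter] at h
  rw [add_comm]
  refine Eq.trans ?_ h
  unfold countBelow
  congr 2 <;> ext j <;> simp [and_comm]

lemma countBelow_compl_eq {n : ℕ} (S : Finset (Fin n)) (i : ℕ) (hi : i ≤ n) :
    countBelow Sᶜ i = i - countBelow S i := by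
  have := countBelow_compl S i hi
  omega

lemma stepMap_compl_val {k n : ℕ} (S : Finset (Fin n)) (hS : Sᶜ.card = k) (i : Fin (n + 1)) :
    (((stepMap Sᶜ hS).toOrderHom i : Fin (k + 1)) : ℕ) = i - countBelow S i :=
  countBelow_compl_eq S i (Nat.lt_succ_iff.1 i.isLt)

lemma countBelow_zero {n : ℕ} (S : Finset (Fin n)) : countBelow S 0 = 0 := by
  simp [countBelow]

lemma countBelow_le {n : ℕ} (S : Finset (Fin n)) (i : ℕ) (hi : i ≤ n) : countBelow S i ≤ i := by
  have := countBelow_compl S i hi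
  omega

/-- The last `s` steps of the `r + s` steps of `[r + s]`. -/
def shiftEmb (r s m : ℕ) (h : m = r + s) : Fin s ↪ Fin m where
  toFun j := ⟨r + j, by omega⟩
  inj' i j hij := by
    have := congrArg Fin.val hij
    exact Fin.ext (by simpa using this)

/-- Truncated subtraction is intended: for `i ≤ r` both counts are zero. -/
lemma countBelow_map_shiftEmb (r s m : ℕ) (h : m = r + s) (S : Finset (Fin s)) (i : ℕ) :
    countBelow (S.map (shiftEmb r s m h)) i = countBelow S (i - r) := by
  unfold countBelow
  rw [Finset.filter_map, Finset.card_map]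
  congr 1
  refine Finset.filter_congr fun j _ => ?_
  change r + (j : ℕ) < i ↔ _
  omega

lemma exists_map_shiftEmb (r s m : ℕ) (h : m = r + s) (S : Finset (Fin m))
    (hS : ∀ j ∈ S, r ≤ (j : ℕ)) : ∃ T : Finset (Fin s), T.map (shiftEmb r s m h) = S := by
  refine ⟨Finset.univ.filter fun j => shiftEmb r s m h j ∈ S, ?_⟩
  ext j
  simp only [Finset.mem_map, Finset.mem_filter, Finset.mem_univ, true_and]
  constructor
  · rintro ⟨l, hl, rfl⟩
    exact hl
  · intro hj
    have hl : shiftEmb r s m h ⟨j - r, by have := hS j hj; omega⟩ = j :=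
      Fin.ext (Nat.add_sub_cancel' (hS j hj))
    exact ⟨_, hl.symm ▸ hj, hl⟩

/-! ## The coaction on shuffle products -/

/-- On a step of `S` the complementary map is constant. If the step lies in the front face, the
resulting simplex of `Bπ` is degenerate. This removes most shuffles from the coaction. -/
lemma mk_KB_of_eq_zero {r s m n : ℕ} (hm : m = r + s) (S : Finset (Fin m)) (hS : Sᶜ.card = n)
    (j : Fin m) (hj : j ∈ S) (hjr : (j : ℕ) < r) (b : BObj ⦋n⦌) :
    NC.mk KB r (KB.of (BMap (front r s m hm ≫ stepMap Sᶜ hS) b)) = 0 := by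
  obtain ⟨r, rfl⟩ : ∃ r', r = r' + 1 := ⟨r - 1, by omega⟩
  obtain ⟨m, rfl⟩ : ∃ m', m = m' + 1 := ⟨m - 1, by omega⟩
  rw [← act_KB_of, Submodule.mkQ_apply, Submodule.Quotient.mk_eq_zero]
  exact act_mem_degen KB _ ⟨j, hjr⟩ (stepMap_castSucc Sᶜ hS j (by simpa using hj)) _

/-- At `(a, b)` the interchange map is `orbMap b` of an evaluation, so naturality of the coaction
gives a label that depends on `b` but not on `a`. -/
lemma isGrouplike_totEv_interchange (V : CSMod.{u}) (k : ℕ) {X n : SimplexCategory}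
    (a : n ⟶ ⦋k⦌) (b : n ⟶ X) {z : (hOrb (tot V)).obj (op X)} {β : BObj X}
    (hz : IsGrouplike (rho1 (tot V)) z β) :
    IsGrouplike (rhoCos V k)
      (totEv (hOrbCos V) X ⦋k⦌ n a b (((interchange V).app (op X)).hom z)) (BMap b β) := by
  have h := LinearMap.congr_fun (orbCoact_orbMap b (totEv V X ⦋k⦌ n a b)) z
  refine h.trans ((congrArg (TensorProduct.map (Lin.map (BMap b))
    (orbMap b (totEv V X ⦋k⦌ n a b))) hz).trans ?_)
  exact congrArg (· ⊗ₜ[F2] orbMap b (totEv V X ⦋k⦌ n a b) z) (Lin.map_of (BMap b) β)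

lemma phiComp_mk (V : CSMod.{u}) (k q n : ℕ) (h : n = q + k) (f : (tot V) _⦋q⦌) :
    phiComp V k q n h (NC.mk (tot V) q f) = ∑ S : Shuffle k n, (coface V k n).mkQ
      (NC.mk (V.obj ⦋k⦌) n (totEv V ⦋q⦌ ⦋k⦌ ⦋n⦌ (stepMap S.1 S.2)
        (stepMap S.1ᶜ (card_compl_shuffle h S)) f)) := by
  change (coface V k n).mkQ (NC.mk (V.obj ⦋k⦌) n (shufEv V k q n h f)) = _
  rw [shufEv, LinearMap.sum_apply, map_sum, map_sum]

lemma Phi_mk (V : CSMod.{u}) (n : ℕ) (z : (hOrb (tot V)) _⦋n⦌) (k s : ℕ)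
    (hs : (s : ℤ) = (n : ℤ) + k) :
    Phi V n (NC.mk _ n z) ⟨(k, s), hs⟩ = phiComp (hOrbCos V) k n s (by omega)
      (NC.mk _ n (((interchange V).app (op ⦋n⦌)).hom z)) := rfl

lemma rhoCN_phiComp (V : CSMod.{u}) (k r s n m : ℕ) (hm : m = r + s) (h : m = n + k)
    {z : (hOrb (tot V)) _⦋n⦌} {β : BObj ⦋n⦌} (hz : IsGrouplike (rho1 (tot V)) z β) :
    rhoCN V k r s m hm (phiComp (hOrbCos V) k n m h
      (NC.mk _ n (((interchange V).app (op ⦋n⦌)).hom z))) =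
    ∑ S : Shuffle k m,
      NC.mk KB r (KB.of (BMap (front r s m hm ≫ stepMap S.1ᶜ (card_compl_shuffle h S)) β)) ⊗ₜ[F2]
        (coface (hOrbCos V) k s).mkQ (NC.mk _ s (totEv (hOrbCos V) ⦋n⦌ ⦋k⦌ ⦋s⦌
          (back r s m hm ≫ stepMap S.1 S.2)
          (back r s m hm ≫ stepMap S.1ᶜ (card_compl_shuffle h S))
          (((interchange V).app (op ⦋n⦌)).hom z))) := by
  rw [phiComp_mk, map_sum]
  refine Finset.sum_congr rfl fun S _ => ?_
  rw [rhoCN_mkQ, coactN_mk hm (isGrouplike_totEv_interchange V k _ _ hz), LinearMap.lTensor_tmul,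
    BMap_BMap, ← act_totEv]
  rfl

/-- Here `s < k`, so the `k` steps of a shuffle do not fit among the last `s` steps; one of them is
among the first `r` and kills the term. -/
lemma rhoCN_phiComp_of_lt (V : CSMod.{u}) (k r s n m : ℕ) (hm : m = r + s) (h : m = n + k)
    (hn : n < r) {z : (hOrb (tot V)) _⦋n⦌} {β : BObj ⦋n⦌}
    (hz : IsGrouplike (rho1 (tot V)) z β) :
    rhoCN V k r s m hm (phiComp (hOrbCos V) k n m h
      (NC.mk _ n (((interchange V).app (op ⦋n⦌)).hom z))) = 0 := by
  rw [rhoCN_phiComp V k r s n m hm h hz]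
  refine Finset.sum_eq_zero fun S _ => ?_
  obtain ⟨j, hj, hjr⟩ : ∃ j ∈ S.1, (j : ℕ) < r := by
    by_contra! hc
    obtain ⟨T, hT⟩ := exists_map_shiftEmb r s m hm S.1 hc
    have h1 := S.2
    rw [← hT, Finset.card_map] at h1
    have h2 := Finset.card_le_univ T
    rw [Fintype.card_fin] at h2
    omega
  rw [mk_KB_of_eq_zero hm S.1 _ j hj hjr, zero_tmul]

/-- Only shuffles without steps of `S` among the first `r` contribute. They are the shifts of the
shuffles of the last `s` steps, which index the right side. -/
lemma rhoCN_phiComp_of_add (V : CSMod.{u}) (k r i s n m : ℕ) (hn : n = r + i) (hs : s = i + k)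
    (hm : m = r + s) (h : m = n + k)
    {z : (hOrb (tot V)) _⦋n⦌} {β : BObj ⦋n⦌} (hz : IsGrouplike (rho1 (tot V)) z β) :
    rhoCN V k r s m hm (phiComp (hOrbCos V) k n m h
      (NC.mk _ n (((interchange V).app (op ⦋n⦌)).hom z))) =
    NC.mk KB r (KB.of (BMap (front r i n hn) β)) ⊗ₜ[F2]
      phiComp (hOrbCos V) k i s hs (NC.mk _ i (((interchange V).app (op ⦋i⦌)).hom
        (act (hOrb (tot V)) (back r i n hn) z))) := by
  rw [rhoCN_phiComp V k r s n m hm h hz, phiComp_mk, tmul_sum]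
  symm
  refine Finset.sum_of_injOn
    (fun T : Shuffle k s => (⟨T.1.map (shiftEmb r s m hm), (Finset.card_map _).trans T.2⟩ :
      Shuffle k m)) ?_ ?_ ?_ ?_
  · intro T _ T' _ hTT
    exact Subtype.ext (Finset.map_injective _ (congrArg Subtype.val hTT))
  · intro T _
    simp
  · intro S _ hS
    obtain ⟨j, hj, hjr⟩ : ∃ j ∈ S.1, (j : ℕ) < r := by
      by_contra! hc
      obtain ⟨T, hT⟩ := exists_map_shiftEmb r s m hm S.1 hc
      refine hS ⟨⟨T, by rw [← S.2, ← hT, Finset.card_map]⟩, by simp, Subtype.ext hT⟩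
    rw [mk_KB_of_eq_zero hm S.1 _ j hj hjr, zero_tmul]
  · intro T _
    have h1 : front r s m hm ≫ stepMap (T.1.map (shiftEmb r s m hm))ᶜ
        (card_compl_shuffle h ⟨_, (Finset.card_map _).trans T.2⟩) = front r i n hn :=
      hom_ext_val fun l => by
        rw [comp_val, stepMap_compl_val, front_val, front_val, countBelow_map_shiftEmb,
          Nat.sub_eq_zero_of_le (Nat.lt_succ_iff.1 l.isLt), countBelow_zero, Nat.sub_zero]
    have h2 : back r s m hm ≫ stepMap (T.1.map (shiftEmb r s m hm)) ((Finset.card_map _).trans T.2) =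
        stepMap T.1 T.2 :=
      hom_ext_val fun l => by
        rw [comp_val, stepMap_val, back_val, stepMap_val, countBelow_map_shiftEmb,
          Nat.add_sub_cancel_left]
    -- After `r` initial steps in the second direction, the second coordinate continues from the
    -- vertex `r` of `[n]`, that is, inside the back face.
    have h3 : back r s m hm ≫ stepMap (T.1.map (shiftEmb r s m hm))ᶜ
        (card_compl_shuffle h ⟨_, (Finset.card_map _).trans T.2⟩) =
        stepMap T.1ᶜ (card_compl_shuffle hs T) ≫ back r i n hn :=
      hom_ext_val fun l => by
        rw [comp_val, comp_val, stepMap_compl_val, back_val, back_val, stepMap_compl_val,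
          countBelow_map_shiftEmb, Nat.add_sub_cancel_left]
        have := countBelow_le T.1 l (Nat.lt_succ_iff.1 l.isLt)
        omega
    rw [h1, h2, h3, app_act, ← totEv_act]
    rfl

/-- The map `φ_∞ ∘ N(ζ)` commutes with the coactions. -/
lemma rho3_Phi (V : CSMod.{u}) (r i n : ℕ) (h : n = r + i) (h' : (n : ℤ) = (r : ℤ) + (i : ℤ))
    (x : NC (hOrb (tot V)) n) :
    rho3 V r i n h' (Phi V n x) =
      LinearMap.lTensor (Wbar r) (Phi V i) (rho2 (tot V) r i n h x) := by
  refine lTensor_TCN_ext fun k s hs => ?_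
  rw [lTensor_proj_rho3 V r i n h' _ k s (r + s) hs rfl (by push_cast; omega)]
  refine LinearMap.congr_fun (f := rhoCN V k r s (r + s) rfl ∘ₗ
    LinearMap.proj (⟨(k, r + s), by push_cast; omega⟩ : TIdx n) ∘ₗ Phi V n)
    (g := LinearMap.lTensor (Wbar r) (LinearMap.proj (⟨(k, s), hs⟩ : TIdx i)) ∘ₗ
      LinearMap.lTensor (Wbar r) (Phi V i) ∘ₗ coactN (rho1 (tot V)) r i n h)
    ((isGrouplikeSpanned_rho1 (tot V)).ext fun z b hz => ?_) x
  rw [LinearMap.comp_apply, LinearMap.comp_apply, LinearMap.comp_apply, LinearMap.comp_apply,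
    coactN_mk h hz, LinearMap.lTensor_tmul, LinearMap.lTensor_tmul, LinearMap.proj_apply,
    LinearMap.proj_apply, Phi_mk, Phi_mk]
  exact rhoCN_phiComp_of_add V k r i s n (r + s) h (by omega) rfl (by omega) hz

lemma rho3_Phi_of_neg (V : CSMod.{u}) (r n : ℕ) (i : ℤ) (h : (n : ℤ) = (r : ℤ) + i)
    (x : NC (hOrb (tot V)) n) (hi : i < 0) : rho3 V r i n h (Phi V n x) = 0 := by
  refine lTensor_TCN_ext fun k s hs => ?_
  rw [lTensor_proj_rho3 V r i n h _ k s (r + s) hs rfl (by push_cast; omega), map_zero]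
  refine LinearMap.congr_fun (f := rhoCN V k r s (r + s) rfl ∘ₗ
    LinearMap.proj (⟨(k, r + s), by push_cast; omega⟩ : TIdx n) ∘ₗ Phi V n) (g := 0)
    ((isGrouplikeSpanned_rho1 (tot V)).ext fun z b hz => ?_) x
  rw [LinearMap.comp_apply, LinearMap.comp_apply, LinearMap.proj_apply, Phi_mk]
  exact rhoCN_phiComp_of_lt V k r s n (r + s) rfl (by omega) (by omega) hz

/-! ## The boundary of the shuffle product -/

/-- The step from `l` to `l + 1` belongs to `S`. -/
def HasStep {n : ℕ} (S : Finset (Fin n)) (l : ℕ) : Prop := ∃ h : l < n, (⟨l, h⟩ : Fin n) ∈ S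

lemma HasStep.lt {n : ℕ} {S : Finset (Fin n)} {l : ℕ} (h : HasStep S l) : l < n := h.1

lemma hasStep_compl {n : ℕ} (S : Finset (Fin n)) (l : ℕ) (hl : l < n) :
    HasStep Sᶜ l ↔ ¬ HasStep S l := by
  simp [HasStep, hl]

lemma countBelow_succ_of_hasStep {n : ℕ} {S : Finset (Fin n)} {l : ℕ} (h : HasStep S l) :
    countBelow S (l + 1) = countBelow S l + 1 := by
  obtain ⟨hl, h⟩ := h
  have : (S.filter fun j : Fin n => (j : ℕ) < l + 1) =
      insert ⟨l, hl⟩ (S.filter fun j : Fin n => (j : ℕ) < l) := by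
    ext j
    simp only [Finset.mem_filter, Finset.mem_insert, Fin.ext_iff]
    constructor
    · rintro ⟨hj, hjl⟩
      by_cases hjl' : (j : ℕ) = l
      · exact Or.inl hjl'
      · exact Or.inr ⟨hj, by omega⟩
    · rintro (hj | ⟨hj, hjl⟩)
      · have : j = ⟨l, hl⟩ := Fin.ext hj
        exact ⟨this ▸ h, by omega⟩
      · exact ⟨hj, by omega⟩
  unfold countBelow
  rw [this, Finset.card_insert_of_notMem (by simp)]

lemma countBelow_succ_of_not_hasStep {n : ℕ} {S : Finset (Fin n)} {l : ℕ} (h : ¬ HasStep S l) :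
    countBelow S (l + 1) = countBelow S l := by
  unfold countBelow
  congr 1
  refine Finset.filter_congr fun j hj => ?_
  have : (j : ℕ) ≠ l := by
    rintro rfl
    exact h ⟨j.isLt, hj⟩
  omega

/-- Induction step for comparing a path with its merged path; the offset `c` is `0` before the
omitted vertex and `1` after it. -/
lemma countBelow_succ_congr {n m : ℕ} {S : Finset (Fin n)} {T : Finset (Fin m)} {l l' c : ℕ}
    (h : HasStep S l ↔ HasStep T l') (hc : countBelow S l = countBelow T l' + c) :
    countBelow S (l + 1) = countBelow T (l' + 1) + c := by
  by_cases hS : HasStep S l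
  · rw [countBelow_succ_of_hasStep hS, countBelow_succ_of_hasStep (h.1 hS), hc]
    omega
  · rw [countBelow_succ_of_not_hasStep hS, countBelow_succ_of_not_hasStep (fun hT => hS (h.2 hT)),
      hc]

lemma countBelow_mono {n : ℕ} (S : Finset (Fin n)) {i i' : ℕ} (h : i ≤ i') :
    countBelow S i ≤ countBelow S i' :=
  Finset.card_le_card fun j hj => by
    simp only [Finset.mem_filter] at hj ⊢
    exact ⟨hj.1, lt_of_lt_of_le hj.2 h⟩

lemma countBelow_succ_le {n : ℕ} (S : Finset (Fin n)) (l : ℕ) :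
    countBelow S (l + 1) ≤ countBelow S l + 1 := by
  by_cases hS : HasStep S l
  · rw [countBelow_succ_of_hasStep hS]
  · rw [countBelow_succ_of_not_hasStep hS]
    omega

lemma countBelow_self {n : ℕ} (S : Finset (Fin n)) : countBelow S n = S.card := by
  unfold countBelow
  rw [Finset.filter_true_of_mem fun j _ => j.isLt]

lemma eq_of_hasStep_iff {n : ℕ} {S T : Finset (Fin n)}
    (h : ∀ l < n, HasStep S l ↔ HasStep T l) : S = T := by
  ext j
  have := h j j.isLt
  simpa [HasStep] using this

/-- The steps before and after the vertex `j` of `[n]` belong to `S`. -/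
def IsFlat {n : ℕ} (S : Finset (Fin n)) (j : ℕ) : Prop :=
  (j < n → HasStep S j) ∧ (0 < j → HasStep S (j - 1))

/-- `T` is obtained from `S` by omitting the vertex `j` of `[n + 1]`, whose adjacent steps belong
to `S`, and merging these steps. -/
structure IsMerge {n : ℕ} (S : Finset (Fin (n + 1))) (j : ℕ) (T : Finset (Fin n)) : Prop where
  le : j ≤ n + 1
  flat : IsFlat S j
  of_lt : ∀ l < j, l < n → (HasStep S l ↔ HasStep T l)
  of_le : ∀ l, j ≤ l → (HasStep S (l + 1) ↔ HasStep T l)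

namespace IsMerge

variable {n : ℕ} {S S' : Finset (Fin (n + 1))} {j j' : ℕ} {T : Finset (Fin n)}

lemma countBelow_of_le (h : IsMerge S j T) (m : ℕ) (hj : m ≤ j) (hn : m ≤ n) :
    countBelow S m = countBelow T m := by
  induction m with
  | zero => rw [countBelow_zero, countBelow_zero]
  | succ m ih =>
    exact countBelow_succ_congr (c := 0) (h.of_lt m (by omega) (by omega))
      (ih (by omega) (by omega))

lemma countBelow_of_ge (h : IsMerge S j T) (m : ℕ) (hj : j ≤ m) (hn : m ≤ n) :
    countBelow S (m + 1) = countBelow T m + 1 := by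
  induction m, hj using Nat.le_induction with
  | base => rw [countBelow_succ_of_hasStep (h.flat.1 (by omega)), h.countBelow_of_le j le_rfl hn]
  | succ m hm ih => exact countBelow_succ_congr (h.of_le m hm) (ih (by omega))

lemma card_eq (h : IsMerge S j T) : S.card = T.card + 1 := by
  rw [← countBelow_self S, ← countBelow_self T]
  by_cases hj : j ≤ n
  · exact h.countBelow_of_ge n hj le_rfl
  · obtain rfl : j = n + 1 := le_antisymm h.le (by omega)
    have h1 : HasStep S n := h.flat.2 (by omega)
    rw [countBelow_succ_of_hasStep h1, h.countBelow_of_le n (by omega) le_rfl]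

/-- The step of `S` that enters vertex `j` raises the count, so the position of `j` can be read off
from its value and `T`. This makes merging injective and turns the face omitting `j` into a coface
on the target. -/
lemma lt_iff (h : IsMerge S j T) (m : ℕ) (hn : m ≤ n) :
    m < j ↔ countBelow T m < countBelow S j := by
  constructor
  · intro hm
    obtain ⟨j, rfl⟩ : ∃ j', j = j' + 1 := ⟨j - 1, by omega⟩
    have h1 : HasStep S j := h.flat.2 (by omega)
    rw [countBelow_succ_of_hasStep h1, ← h.countBelow_of_le m (by omega) hn, Nat.lt_succ_iff]
    exact countBelow_mono S (by omega)
  · intro hc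
    by_contra! hm
    rw [h.countBelow_of_le j le_rfl (by omega)] at hc
    have := countBelow_mono T hm
    omega

/-- A merged shuffle determines the original one, given the omitted value. -/
lemma unique (h : IsMerge S j T) (h' : IsMerge S' j' T)
    (hc : countBelow S j = countBelow S' j') : S = S' ∧ j = j' := by
  have hjj : j = j' := by
    have h1 := h.le
    have h2 := h'.le
    have h3 : ∀ m ≤ n, (m < j ↔ m < j') := fun m hm => by
      rw [h.lt_iff m hm, h'.lt_iff m hm, hc]
    rcases lt_trichotomy j j' with hlt | rfl | hlt
    · have := (h3 j (by omega)).2 hlt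
      omega
    · rfl
    · have := (h3 j' (by omega)).1 hlt
      omega
  subst hjj
  refine ⟨eq_of_hasStep_iff fun l hl => ?_, rfl⟩
  rcases lt_trichotomy l j with hlj | rfl | hlj
  · by_cases hln : l < n
    · rw [h.of_lt l hlj hln, h'.of_lt l hlj hln]
    -- Here `l = n` and `j = n + 1`: the last step is not recorded in `T`, but flatness puts it in
    -- both sets.
    · have := h.le
      obtain rfl : l = j - 1 := by omega
      exact iff_of_true (h.flat.2 (by omega)) (h'.flat.2 (by omega))
  · exact iff_of_true (h.flat.1 hl) (h'.flat.1 hl)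
  · obtain ⟨l, rfl⟩ : ∃ l', l = l' + 1 := ⟨l - 1, by omega⟩
    rw [h.of_le l (by omega), h'.of_le l (by omega)]

end IsMerge

open Classical in
/-- The set of steps given by a predicate. -/
def stepsOf (n : ℕ) (P : ℕ → Prop) : Finset (Fin n) := Finset.univ.filter fun l => P l

lemma hasStep_stepsOf (n : ℕ) (P : ℕ → Prop) (l : ℕ) : HasStep (stepsOf n P) l ↔ l < n ∧ P l := by
  simp [HasStep, stepsOf]

/-- Merging the two steps adjacent to `j`. -/
def merge {n : ℕ} (S : Finset (Fin (n + 1))) (j : ℕ) : Finset (Fin n) :=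
  stepsOf n fun l => (l < j ∧ HasStep S l) ∨ (j ≤ l ∧ HasStep S (l + 1))

lemma isMerge_merge {n : ℕ} (S : Finset (Fin (n + 1))) (j : ℕ) (hj : j ≤ n + 1)
    (h : IsFlat S j) : IsMerge S j (merge S j) where
  le := hj
  flat := h
  of_lt l hl hn := by
    rw [merge, hasStep_stepsOf]
    have : ¬ j ≤ l := by omega
    tauto
  of_le l hl := by
    rw [merge, hasStep_stepsOf]
    have : ¬ l < j := by omega
    have h1 : HasStep S (l + 1) → l < n := fun h => by have := h.lt; omega
    tauto

/-- Inverse of merging: vertex `j` is the first one at which the count of `T` reaches `i`, or `n +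
1` if there is none, and a step is inserted there. -/
lemma exists_isMerge {n : ℕ} (T : Finset (Fin n)) (i : ℕ) (hi : i ≤ T.card + 1) :
    ∃ S j, IsMerge S j T ∧ countBelow S j = i := by
  obtain ⟨j, hjn, hj⟩ : ∃ j ≤ n + 1, ∀ m ≤ n, (m < j ↔ countBelow T m < i) := by
    by_cases hex : ∃ m, m ≤ n ∧ i ≤ countBelow T m
    · classical
      refine ⟨Nat.find hex, ?_, fun m hm => ?_⟩
      · have := (Nat.find_spec hex).1
        omega
      · rw [Nat.lt_find_iff]
        constructor
        · intro h
          have := h m le_rfl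
          push Not at this
          exact this hm
        · rintro h m' hm' ⟨-, h2⟩
          have := countBelow_mono T hm'
          omega
    · push Not at hex
      exact ⟨n + 1, le_rfl, fun m hm => iff_of_true (by omega) (hex m hm)⟩
  -- The count first reaches `i` at `j`, so it increases on the step before.
  have hT : 0 < j → j ≤ n → HasStep T (j - 1) := by
    intro h0 hn
    by_contra hc
    have h1 := (hj (j - 1) (by omega)).1 (by omega)
    rw [← countBelow_succ_of_not_hasStep hc, Nat.sub_add_cancel h0] at h1
    have h2 := (hj j hn).2 h1
    omega
  -- The inserted step is `j`, except for `j = n + 1`, when it is the last step `n`.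
  let S : Finset (Fin (n + 1)) := stepsOf (n + 1) fun l =>
    (l < j ∧ HasStep T l) ∨ l = j ∨ (j < l ∧ HasStep T (l - 1)) ∨ (l = n ∧ j = n + 1)
  have hS : IsMerge S j T := by
    refine ⟨hjn, ⟨fun h => ?_, fun h => ?_⟩, fun l hl hn => ?_, fun l hl => ?_⟩
    · rw [hasStep_stepsOf]
      exact ⟨h, Or.inr (Or.inl rfl)⟩
    · rw [hasStep_stepsOf]
      refine ⟨by omega, ?_⟩
      by_cases hjn' : j = n + 1
      · exact Or.inr (Or.inr (Or.inr ⟨by omega, hjn'⟩))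
      · exact Or.inl ⟨by omega, hT h (by omega)⟩
    · rw [hasStep_stepsOf]
      have h1 : ¬ l = j := by omega
      have h2 : ¬ j < l := by omega
      have h3 : ¬ l = n := by omega
      have h4 : l < n + 1 := by omega
      tauto
    · rw [hasStep_stepsOf, Nat.add_sub_cancel]
      have h1 : ¬ l + 1 < j := by omega
      have h2 : ¬ l + 1 = j := by omega
      have h3 : j < l + 1 := by omega
      have h4 : ¬ (l + 1 = n ∧ j = n + 1) := by omega
      have h5 : HasStep T l → l + 1 < n + 1 := fun h => by have := h.lt; omega
      tauto
  refine ⟨S, j, hS, ?_⟩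
  rcases Nat.eq_zero_or_pos j with rfl | h0
  · rw [countBelow_zero]
    by_contra hne
    have := (hj 0 (by omega)).2 (by rw [countBelow_zero]; omega)
    omega
  · obtain ⟨j, rfl⟩ : ∃ j', j = j' + 1 := ⟨j - 1, by omega⟩
    have h1 : HasStep S j := hS.flat.2 (by omega)
    have h2 := (hj j (by omega)).1 (by omega)
    rw [countBelow_succ_of_hasStep h1, hS.countBelow_of_le j (by omega) (by omega)]
    by_cases hjn' : j = n
    · subst hjn'
      rw [countBelow_self] at h2 ⊢
      omega
    · have h3 := (hj (j + 1) (by omega)).not.1 (by omega)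
      have h4 := countBelow_succ_le T j
      omega

/-! ### Faces of the shuffle product -/

section Sums

variable {M : Type u} [AddCommGroup M]

/-- The sum of the values of `F` on the simplices of the shuffle product of the top simplices of
`Δ^k` and `Δ^q`. -/
def shufSum (k q n : ℕ) (h : n = q + k) (F : (⦋n⦌ ⟶ ⦋k⦌) → (⦋n⦌ ⟶ ⦋q⦌) → M) : M :=
  ∑ S : Shuffle k n, F (stepMap S.1 S.2) (stepMap S.1ᶜ (card_compl_shuffle h S))

/-- The value of `F` on the face opposite to a vertex of a simplex of the shuffle product. -/
def omitVertex {k q s : ℕ} (h : s + 1 = q + k) (F : (⦋s⦌ ⟶ ⦋k⦌) → (⦋s⦌ ⟶ ⦋q⦌) → M)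
    (x : Shuffle k (s + 1) × Fin (s + 2)) : M :=
  F (SimplexCategory.δ x.2 ≫ stepMap x.1.1 x.1.2)
    (SimplexCategory.δ x.2 ≫ stepMap x.1.1ᶜ (card_compl_shuffle h x.1))

open Classical in
/-- The part of the boundary of the shuffle product given by vertices whose adjacent steps are both
in the first direction. -/
def flatSum (k q s : ℕ) (h : s + 1 = q + k) (F : (⦋s⦌ ⟶ ⦋k⦌) → (⦋s⦌ ⟶ ⦋q⦌) → M) : M :=
  ∑ x : Shuffle k (s + 1) × Fin (s + 2), if IsFlat x.1.1 x.2 then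
    omitVertex h F x else 0

/-- There are no steps in the first direction, while every vertex has at least one adjacent step. -/
lemma flatSum_zero (q s : ℕ) (h : s + 1 = q + 0) (F : (⦋s⦌ ⟶ ⦋0⦌) → (⦋s⦌ ⟶ ⦋q⦌) → M) :
    flatSum 0 q s h F = 0 := by
  refine Finset.sum_eq_zero fun x _ => if_neg ?_
  rintro ⟨h1, h2⟩
  have hx : x.1.1 = ∅ := Finset.card_eq_zero.1 x.1.2
  rw [hx] at h1 h2
  have h3 : ∀ l, ¬ HasStep (∅ : Finset (Fin (s + 1))) l := by simp [HasStep]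
  by_cases h0 : 0 < (x.2 : ℕ)
  · exact h3 _ (h2 h0)
  · exact h3 _ (h1 (by omega))

/-- Merging is a bijection from shuffles with a flat vertex to pairs of a shorter shuffle and a
vertex `i` of `[k + 1]`, the first coordinate of the omitted vertex. The face is the shorter shuffle
with `δ i` applied to its first coordinate. -/
lemma flatSum_succ (k q s : ℕ) (h : s + 1 = q + (k + 1)) (h' : s = q + k)
    (F : (⦋s⦌ ⟶ ⦋k + 1⦌) → (⦋s⦌ ⟶ ⦋q⦌) → M) :
    flatSum (k + 1) q s h F =
      ∑ i : Fin (k + 2), shufSum k q s h' fun a b => F (a ≫ SimplexCategory.δ i) b := by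
  classical
  unfold flatSum shufSum
  rw [← Finset.sum_filter, Finset.sum_comm, ← Finset.sum_product']
  have hm : ∀ x : Shuffle (k + 1) (s + 1) × Fin (s + 2), IsFlat x.1.1 x.2 →
      IsMerge x.1.1 x.2 (merge x.1.1 x.2) := fun x hx =>
    isMerge_merge _ _ (Nat.lt_succ_iff.1 x.2.isLt) hx
  refine Finset.sum_bij (fun x hx => ((⟨merge x.1.1 x.2, by
      have h1 := (hm x (Finset.mem_filter.1 hx).2).card_eq
      have h2 := x.1.2
      omega⟩ : Shuffle k s), (⟨countBelow x.1.1 x.2, by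
      have h1 := countBelow_mono x.1.1 (Nat.lt_succ_iff.1 x.2.isLt)
      rw [countBelow_self, x.1.2] at h1
      omega⟩ : Fin (k + 2)))) ?_ ?_ ?_ ?_
  · intro x _
    simp
  · intro x hx y hy hxy
    simp only [Prod.mk.injEq, Subtype.mk.injEq, Fin.mk.injEq] at hxy
    have hmx := hm x (Finset.mem_filter.1 hx).2
    have hmy := hm y (Finset.mem_filter.1 hy).2
    rw [hxy.1] at hmx
    obtain ⟨h1, h2⟩ := hmx.unique hmy hxy.2
    exact Prod.ext (Subtype.ext h1) (Fin.ext h2)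
  · rintro ⟨T, i⟩ -
    obtain ⟨S, j, hS, hi⟩ := exists_isMerge T.1 i (by rw [T.2]; omega)
    have hflat := hS.flat
    have hj : j < s + 2 := by have := hS.le; omega
    refine ⟨(⟨S, by rw [hS.card_eq, T.2]⟩, ⟨j, hj⟩), Finset.mem_filter.2 ⟨by simp, hflat⟩, ?_⟩
    have hT : merge S j = T.1 := by
      have h1 := isMerge_merge S j hS.le hflat
      refine eq_of_hasStep_iff fun l hl => ?_
      by_cases hlj : l < j
      · rw [← h1.of_lt l hlj hl, hS.of_lt l hlj hl]
      · rw [← h1.of_le l (by omega), hS.of_le l (by omega)]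
    exact Prod.ext (Subtype.ext hT) (Fin.ext hi)
  · intro x hx
    have hmx := hm x (Finset.mem_filter.1 hx).2
    -- By `lt_iff` the case distinction on the position of `l` becomes one on its value, as in the
    -- formula for `δ i`.
    have hval : ∀ l : Fin (s + 1), countBelow x.1.1 ((SimplexCategory.δ x.2).toOrderHom l :
        Fin (s + 2)) = if countBelow (merge x.1.1 x.2) l < countBelow x.1.1 x.2 then
          countBelow (merge x.1.1 x.2) l else countBelow (merge x.1.1 x.2) l + 1 := by
      intro l
      have hl : (l : ℕ) ≤ s := Nat.lt_succ_iff.1 l.isLt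
      rw [δ_val]
      simp only [← hmx.lt_iff l hl]
      split_ifs with hlt
      · exact hmx.countBelow_of_le l hlt.le hl
      · exact hmx.countBelow_of_ge l (not_lt.1 hlt) hl
    refine congrArg₂ F ?_ ?_
    · refine hom_ext_val fun l => ?_
      rw [comp_val, comp_val, stepMap_val, hval, δ_val, stepMap_val]
    · refine hom_ext_val fun l => ?_
      have hl : (l : ℕ) ≤ s := Nat.lt_succ_iff.1 l.isLt
      rw [comp_val, stepMap_compl_val, hval, δ_val, stepMap_compl_val]
      simp only [← hmx.lt_iff l hl]
      split_ifs
      · rfl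
      · omega

/-- Exchanging the two steps adjacent to the vertex `j`. -/
def swapAt {s : ℕ} (j : Fin (s + 2)) (S : Finset (Fin (s + 1))) : Finset (Fin (s + 1)) :=
  -- The two entries coincide for `j = 0` and `j = s + 1`, so nothing is exchanged at the end
  -- vertices.
  S.map (Equiv.swap (⟨j - 1, by omega⟩ : Fin (s + 1)) ⟨min j s, by omega⟩).toEmbedding

lemma swapAt_swapAt {s : ℕ} (j : Fin (s + 2)) (S : Finset (Fin (s + 1))) :
    swapAt j (swapAt j S) = S := by
  ext l
  simp [swapAt]

/-- The two exchanged steps lie on the same side of every vertex other than `j`. -/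
lemma countBelow_swapAt {s : ℕ} (j : Fin (s + 2)) (S : Finset (Fin (s + 1))) (i : ℕ)
    (hi : i ≠ j) : countBelow (swapAt j S) i = countBelow S i := by
  unfold countBelow swapAt
  rw [Finset.filter_map, Finset.card_map]
  congr 1
  refine Finset.filter_congr fun l _ => ?_
  simp only [Function.comp_apply, Equiv.coe_toEmbedding, Equiv.swap_apply_def]
  split_ifs with h1 h2
  · rw [Fin.ext_iff] at h1
    simp only at h1 ⊢
    omega
  · rw [Fin.ext_iff] at h2
    simp only at h2 ⊢
    omega
  · rfl

lemma hasStep_swapAt_pred {s : ℕ} (j : Fin (s + 2)) (S : Finset (Fin (s + 1)))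
    (hs : (j : ℕ) ≤ s) : HasStep (swapAt j S) (j - 1) ↔ HasStep S j := by
  have h1 : (j : ℕ) - 1 < s + 1 := by omega
  have h2 : (j : ℕ) < s + 1 := by omega
  simp [HasStep, swapAt, h1, h2, Finset.mem_map_equiv, Equiv.symm_swap, hs]

lemma card_swapAt {s : ℕ} (j : Fin (s + 2)) (S : Finset (Fin (s + 1))) :
    (swapAt j S).card = S.card := Finset.card_map _

/-- Exchanging the two steps adjacent to the given vertex. -/
def swapShuffle {k s : ℕ} (x : Shuffle k (s + 1) × Fin (s + 2)) :
    Shuffle k (s + 1) × Fin (s + 2) :=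
  (⟨swapAt x.2 x.1.1, (card_swapAt x.2 x.1.1).trans x.1.2⟩, x.2)

/-- A face that omits the vertex does not see the order of its two adjacent steps. -/
lemma omitVertex_swapShuffle {N : Type u} {k q s : ℕ} (h : s + 1 = q + k)
    (F : (⦋s⦌ ⟶ ⦋k⦌) → (⦋s⦌ ⟶ ⦋q⦌) → N) (x : Shuffle k (s + 1) × Fin (s + 2)) :
    omitVertex h F (swapShuffle x) = omitVertex h F x := by
  have hval : ∀ l : Fin (s + 1), countBelow (swapAt x.2 x.1.1)
      ((SimplexCategory.δ x.2).toOrderHom l : Fin (s + 2)) =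
      countBelow x.1.1 ((SimplexCategory.δ x.2).toOrderHom l : Fin (s + 2)) := by
    intro l
    refine countBelow_swapAt _ _ _ ?_
    rw [δ_val]
    split_ifs <;> omega
  refine congrArg₂ F (hom_ext_val fun l => hval l) (hom_ext_val fun l => ?_)
  rw [comp_val, comp_val, stepMap_compl_val, stepMap_compl_val]
  exact congrArg (_ - ·) (hval l)

/-- Exactly one of the two steps adjacent to the vertex `j` belongs to `S`. -/
def IsCorner {s : ℕ} (S : Finset (Fin (s + 1))) (j : ℕ) : Prop :=
  0 < j ∧ j ≤ s ∧ (HasStep S j ↔ ¬ HasStep S (j - 1))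

lemma IsCorner.swapAt {s : ℕ} {S : Finset (Fin (s + 1))} {j : Fin (s + 2)} (h : IsCorner S j) :
    IsCorner (swapAt j S) j := by
  obtain ⟨h0, hs, h⟩ := h
  have h1 := hasStep_swapAt_pred j S hs
  have h2 := hasStep_swapAt_pred j (TotComod.swapAt j S) hs
  rw [swapAt_swapAt] at h2
  exact ⟨h0, hs, by tauto⟩

lemma IsCorner.swapAt_ne {s : ℕ} {S : Finset (Fin (s + 1))} {j : Fin (s + 2)}
    (h : IsCorner S j) : TotComod.swapAt j S ≠ S := by
  intro heq
  have h1 := hasStep_swapAt_pred j S h.2.1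
  rw [heq] at h1
  have h2 := h.2.2
  tauto

-- Exchanging the steps at a corner is an involution without fixed points that preserves the face,
-- so the terms cancel in pairs.
open Classical in
lemma sum_omitVertex_corner [Module F2 M] (k q s : ℕ) (h : s + 1 = q + k)
    (F : (⦋s⦌ ⟶ ⦋k⦌) → (⦋s⦌ ⟶ ⦋q⦌) → M) :
    ∑ x : Shuffle k (s + 1) × Fin (s + 2),
      (if IsCorner x.1.1 x.2 then omitVertex h F x else 0) = 0 := by
  rw [← Finset.sum_filter]
  refine Finset.sum_involution (fun x _ => swapShuffle x) ?_ ?_ ?_ ?_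
  · intro x _
    rw [omitVertex_swapShuffle]
    exact add_self_zero _
  · intro x hx _ heq
    exact (Finset.mem_filter.1 hx).2.swapAt_ne
      (congrArg (fun y : Shuffle k (s + 1) × Fin (s + 2) => y.1.1) heq)
  · intro x hx
    exact Finset.mem_filter.2 ⟨Finset.mem_univ _, (Finset.mem_filter.1 hx).2.swapAt⟩
  · intro x _
    exact Prod.ext (Subtype.ext (swapAt_swapAt x.2 x.1.1)) rfl

/-- An inner vertex has two adjacent steps, equal or different in direction; an end vertex has one
and is flat in its direction. -/
lemma isFlat_or_isFlat_compl {s : ℕ} (S : Finset (Fin (s + 1))) (j : Fin (s + 2)) :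
    (IsFlat S j ∨ IsFlat Sᶜ j) ∨ IsCorner S j := by
  have hj := j.isLt
  unfold IsFlat IsCorner
  by_cases h0 : 0 < (j : ℕ) <;> by_cases h1 : (j : ℕ) < s + 1
  · rw [hasStep_compl S j h1, hasStep_compl S (j - 1) (by omega)]
    have : (j : ℕ) ≤ s := by omega
    tauto
  · rw [hasStep_compl S (j - 1) (by omega)]
    tauto
  · rw [hasStep_compl S j h1]
    tauto
  · omega

lemma not_isFlat_and_isFlat_compl {s : ℕ} (S : Finset (Fin (s + 1))) (j : Fin (s + 2)) :
    ¬ (IsFlat S j ∧ IsFlat Sᶜ j) := by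
  have hj := j.isLt
  unfold IsFlat
  by_cases h1 : (j : ℕ) < s + 1
  · rw [hasStep_compl S j h1]
    tauto
  · have h0 : 0 < (j : ℕ) := by omega
    rw [hasStep_compl S (j - 1) (by omega)]
    tauto

lemma IsCorner.not_isFlat {s : ℕ} {S : Finset (Fin (s + 1))} {j : Fin (s + 2)}
    (h : IsCorner S j) : ¬ IsFlat S j ∧ ¬ IsFlat Sᶜ j := by
  obtain ⟨h0, hs, h⟩ := h
  unfold IsFlat
  rw [hasStep_compl S j (by omega), hasStep_compl S (j - 1) (by omega)]
  have : (j : ℕ) < s + 1 := by omega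
  tauto

open Classical in
lemma add_ite_isFlat {s : ℕ} (S : Finset (Fin (s + 1))) (j : Fin (s + 2)) (m : M) :
    (if IsFlat S j then m else 0) + (if IsFlat Sᶜ j then m else 0) +
      (if IsCorner S j then m else 0) = m := by
  have h1 := isFlat_or_isFlat_compl S j
  have h2 := not_isFlat_and_isFlat_compl S j
  by_cases hA : IsFlat S j
  · rw [if_pos hA, if_neg (fun hB => h2 ⟨hA, hB⟩), if_neg (fun hC => hC.not_isFlat.1 hA), add_zero,
      add_zero]
  · by_cases hB : IsFlat Sᶜ j
    · rw [if_neg hA, if_pos hB, if_neg (fun hC => hC.not_isFlat.2 hB), add_zero, zero_add]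
    · rw [if_neg hA, if_neg hB, if_pos (h1.resolve_left (not_or.2 ⟨hA, hB⟩)), zero_add, zero_add]

/-- Exchanging the two directions of a shuffle. -/
def shuffleCompl {k q n : ℕ} (h : n = q + k) (h' : n = k + q) : Shuffle k n ≃ Shuffle q n where
  toFun S := ⟨S.1ᶜ, card_compl_shuffle h S⟩
  invFun S := ⟨S.1ᶜ, card_compl_shuffle h' S⟩
  left_inv S := Subtype.ext (compl_compl S.1)
  right_inv S := Subtype.ext (compl_compl S.1)

/-- The boundary of the shuffle product, modulo two. -/
lemma sum_sum_δ_stepMap [Module F2 M] (k q s : ℕ) (h : s + 1 = q + k) (h' : s + 1 = k + q)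
    (F : (⦋s⦌ ⟶ ⦋k⦌) → (⦋s⦌ ⟶ ⦋q⦌) → M) :
    ∑ S : Shuffle k (s + 1), ∑ j : Fin (s + 2), omitVertex h F (S, j) =
      flatSum k q s h F + flatSum q k s h' fun b a => F a b := by
  classical
  have hcompl : (flatSum q k s h' fun b a => F a b) =
      ∑ x : Shuffle k (s + 1) × Fin (s + 2),
        if IsFlat x.1.1ᶜ x.2 then omitVertex h F x else 0 := by
    symm
    refine Fintype.sum_equiv (Equiv.prodCongr (shuffleCompl h h') (Equiv.refl _)) _ _ fun x => ?_
    simp only [Equiv.prodCongr_apply, Prod.map_fst, Prod.map_snd, shuffleCompl, Equiv.coe_fn_mk,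
      Equiv.refl_apply, omitVertex, compl_compl]
  rw [← add_zero (flatSum k q s h F + _), ← sum_omitVertex_corner k q s h F, hcompl, flatSum,
    ← Finset.sum_product', Finset.univ_product_univ, ← Finset.sum_add_distrib,
    ← Finset.sum_add_distrib]
  exact Finset.sum_congr rfl fun x _ => (add_ite_isFlat x.1.1 x.2 _).symm

end Sums

/-! ## The map `φ_∞` is a chain map -/

lemma phiComp_mk_eq_shufSum (V : CSMod.{u}) (k q n : ℕ) (h : n = q + k) (f : (tot V) _⦋q⦌) :
    phiComp V k q n h (NC.mk (tot V) q f) = shufSum k q n h fun a b =>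
      (coface V k n).mkQ (NC.mk (V.obj ⦋k⦌) n (totEv V ⦋q⦌ ⦋k⦌ ⦋n⦌ a b f)) :=
  phiComp_mk V k q n h f

lemma CN.dv_mk (V : CSMod.{u}) (k s : ℕ) (x : (V.obj ⦋k⦌) _⦋s + 1⦌) :
    CN.dv V k s ((coface V k (s + 1)).mkQ (NC.mk _ (s + 1) x)) =
      ∑ j : Fin (s + 2), (coface V k s).mkQ (NC.mk _ s (act (V.obj ⦋k⦌) (SimplexCategory.δ j) x)) := by
  rw [← map_sum, ← NC.d_mk]
  rfl

lemma dv_phiComp (V : CSMod.{u}) (k q s : ℕ) (h : s + 1 = q + k) (h' : s + 1 = k + q)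
    (f : (tot V) _⦋q⦌) :
    CN.dv V k s (phiComp V k q (s + 1) h (NC.mk (tot V) q f)) =
      flatSum k q s h (fun a b =>
        (coface V k s).mkQ (NC.mk (V.obj ⦋k⦌) s (totEv V ⦋q⦌ ⦋k⦌ ⦋s⦌ a b f))) +
      flatSum q k s h' (fun b a =>
        (coface V k s).mkQ (NC.mk (V.obj ⦋k⦌) s (totEv V ⦋q⦌ ⦋k⦌ ⦋s⦌ a b f))) := by
  rw [← sum_sum_δ_stepMap, phiComp_mk, map_sum]
  refine Finset.sum_congr rfl fun S _ => ?_
  rw [CN.dv_mk]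
  refine Finset.sum_congr rfl fun j _ => ?_
  exact congrArg (fun y => (coface V k s).mkQ (NC.mk (V.obj ⦋k⦌) s y))
    (LinearMap.congr_fun (act_totEv V ⦋q⦌ ⦋k⦌ (SimplexCategory.δ j) (stepMap S.1 S.2)
      (stepMap S.1ᶜ (card_compl_shuffle h S))) f)

/-- Compatibility of `f` with the cosimplicial operators turns `δ i` on the first coordinate into
`d^i`; for `i > 0` this vanishes in the conormalization. -/
lemma flatSum_eq_dh (V : CSMod.{u}) (k q s : ℕ) (h : s + 1 = q + (k + 1)) (h' : s = q + k)
    (f : (tot V) _⦋q⦌) :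
    flatSum (k + 1) q s h (fun a b =>
        (coface V (k + 1) s).mkQ (NC.mk (V.obj ⦋k + 1⦌) s (totEv V ⦋q⦌ ⦋k + 1⦌ ⦋s⦌ a b f))) =
      CN.dh V k s (phiComp V k q s h' (NC.mk (tot V) q f)) := by
  have hδ : ∀ (i : Fin (k + 2)) (a : ⦋s⦌ ⟶ ⦋k⦌) (b : ⦋s⦌ ⟶ ⦋q⦌),
      NC.mk (V.obj ⦋k + 1⦌) s (totEv V ⦋q⦌ ⦋k + 1⦌ ⦋s⦌ (a ≫ SimplexCategory.δ i) b f) =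
        NC.map (V.map (SimplexCategory.δ i)) s
          (NC.mk (V.obj ⦋k⦌) s (totEv V ⦋q⦌ ⦋k⦌ ⦋s⦌ a b f)) := by
    intro i a b
    rw [NC.map_mk, ← app_totEv]
    rfl
  rw [flatSum_succ k q s h h', Fin.sum_univ_succ, Finset.sum_eq_zero, add_zero,
    phiComp_mk_eq_shufSum]
  · unfold shufSum
    rw [map_sum]
    refine Finset.sum_congr rfl fun S _ => ?_
    beta_reduce
    rw [hδ]
    rfl
  · intro i _
    refine Finset.sum_eq_zero fun S _ => ?_
    beta_reduce
    rw [hδ, mkQ_coface_map]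

/-- A coface on the second coordinate is a face of the simplex `f` of `Tot V`; complementing the
shuffles restores the order of the two directions. -/
lemma flatSum_eq_phiComp_d (V : CSMod.{u}) (k q s : ℕ) (h : s + 1 = k + (q + 1))
    (h' : s = q + k) (f : (tot V) _⦋q + 1⦌) :
    flatSum (q + 1) k s h (fun b a =>
        (coface V k s).mkQ (NC.mk (V.obj ⦋k⦌) s (totEv V ⦋q + 1⦌ ⦋k⦌ ⦋s⦌ a b f))) =
      phiComp V k q s h' (NC.d (tot V) q (NC.mk (tot V) (q + 1) f)) := by
  have h'' : s = k + q := by omega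
  rw [flatSum_succ q k s h h'', NC.d_mk, map_sum]
  refine Finset.sum_congr rfl fun i _ => ?_
  rw [phiComp_mk]
  refine Fintype.sum_equiv (shuffleCompl h'' h') _ _ fun S => ?_
  simp only [shuffleCompl, Equiv.coe_fn_mk, compl_compl]
  rw [← totEv_act]
  rfl

/-- The map `φ_∞` is a chain map. -/
lemma d_phi (V : CSMod.{u}) (n : ℕ) (h : ((n + 1 : ℕ) : ℤ) = (n : ℤ) + 1) (x : NC (tot V) (n + 1)) :
    TCN.d V (n + 1 : ℕ) n h (phi V (n + 1) x) = phi V n (NC.d (tot V) n x) := by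
  obtain ⟨f, rfl⟩ := Submodule.mkQ_surjective _ x
  funext ⟨⟨k, s⟩, hs⟩
  have hsn : s = n + k := by simp only at hs; omega
  rcases k with _ | k
  · refine (dv_phiComp V 0 (n + 1) s (by omega) (by omega) f).trans ?_
    rw [flatSum_zero, zero_add, flatSum_eq_phiComp_d V 0 n s (by omega) hsn]
    rfl
  · refine (congrArg (· + CN.dh V k s (phiComp V k (n + 1) s (by omega) (NC.mk (tot V) (n + 1) f)))
      (dv_phiComp V (k + 1) (n + 1) s (by omega) (by omega) f)).trans ?_
    -- The horizontal differential occurs twice, once in the total differential and once in the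
    -- boundary of the shuffle product.
    rw [flatSum_eq_dh V k (n + 1) s (by omega) (by omega),
      flatSum_eq_phiComp_d V (k + 1) n s (by omega) hsn, add_right_comm, add_self_zero, zero_add]
    rfl

/-- Since `Δ^0` has no steps, only the first direction contributes, and it cancels the horizontal
differential. -/
lemma d_phi_zero (V : CSMod.{u}) (j : ℤ) (h : ((0 : ℕ) : ℤ) = j + 1) (x : NC (tot V) 0) :
    TCN.d V (0 : ℕ) j h (phi V 0 x) = 0 := by
  obtain ⟨f, rfl⟩ := Submodule.mkQ_surjective _ x
  funext ⟨⟨k, s⟩, hs⟩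
  rcases k with _ | k
  -- In total degree `-1` the column `k = 0` would need `s = -1`.
  · simp only at hs
    push_cast at hs h
    omega
  · have hsk : s = k := by
      simp only at hs
      push_cast at hs h
      omega
    refine (congrArg (· + CN.dh V k s (phiComp V k 0 s (by omega) (NC.mk (tot V) 0 f)))
      (dv_phiComp V (k + 1) 0 s (by omega) (by omega) f)).trans ?_
    rw [flatSum_eq_dh V k 0 s (by omega) (by omega), flatSum_zero, add_zero, add_self_zero]
    rfl

lemma isDGComoduleMap_Phi (V : CSMod.{u}) :
    IsDGComoduleMap Wbar (NC (hOrb (tot V))) (NC.d' (hOrb (tot V))) (rho2 (tot V))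
      (TCN (hOrbCos V)) (TCN.d (hOrbCos V)) (rho3 V) (Phi V) where
  map_d n m h h' x := by
    subst h
    refine (d_phi (hOrbCos V) m h' (NC.map (interchange V) (m + 1) x)).trans ?_
    rw [NC.d_map]
    rfl
  map_d_zero j h x := d_phi_zero (hOrbCos V) j h (NC.map (interchange V) 0 x)
  map_coact r i n h h' x := rho3_Phi V r i n h h' x
  map_coact_neg r n i h x hi := rho3_Phi_of_neg V r n i h x hi

end TotComod

end

theorem theoremT (V : TotComod.CSMod.{u}) :
    TotComod.IsDGCoalgebra TotComod.Wbar TotComod.Wbar.d TotComod.Wbar.comul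
      TotComod.Wbar.counit ∧
    TotComod.IsDGComodule TotComod.Wbar TotComod.Wbar.d TotComod.Wbar.comul
      TotComod.Wbar.counit
      (TotComod.NC (TotComod.hOrb (TotComod.tot V)))
      (TotComod.NC.d' (TotComod.hOrb (TotComod.tot V)))
      (TotComod.rho2 (TotComod.tot V)) ∧
    TotComod.IsDGComodule TotComod.Wbar TotComod.Wbar.d TotComod.Wbar.comul
      TotComod.Wbar.counit
      (TotComod.TCN (TotComod.hOrbCos V))
      (TotComod.TCN.d (TotComod.hOrbCos V))
      (TotComod.rho3 V) ∧
    TotComod.IsDGComoduleMap TotComod.Wbar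
      (TotComod.NC (TotComod.hOrb (TotComod.tot V)))
      (TotComod.NC.d' (TotComod.hOrb (TotComod.tot V)))
      (TotComod.rho2 (TotComod.tot V))
      (TotComod.TCN (TotComod.hOrbCos V))
      (TotComod.TCN.d (TotComod.hOrbCos V))
      (TotComod.rho3 V)
      (TotComod.Phi V) :=
  ⟨TotComod.isDGCoalgebra_Wbar, TotComod.isDGComodule_rho2 (TotComod.tot V),
    TotComod.isDGComodule_rho3 V, TotComod.isDGComoduleMap_Phi V⟩
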